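/- Let $q$ be a prime power and $n\ge 1$ with $\gcd(q,n)=1$, and let $D_n=\langle a,b\mid a^n=b^2=1,\ bab=a^{-1}\rangle$ be the dihedral group of order $2n$. For $f=\sum_i a_i\mathrm{x}^i\in\mathbb{F}_{q^2}[\mathrm{x}]$ put $\overline f=\sum_i a_i^q\mathrm{x}^i$, and, if $f(0)\ne 0$, $f^*(\mathrm{x})=f(0)^{-1}\mathrm{x}^{\deg f}f(\mathrm{x}^{-1})$ and $f^\dagger=\overline{f^*}$. Write $$\mathrm{x}^n-1=\prod_{j\in J_0}f_j\prod_{j\in J_1}f_j\overline{f_j}\prod_{j\in J_2\cup J_3}f_jf_j^*\prod_{j\in J_4}f_jf_j^*\overline{f_j}f_j^\dagger$$ with all $f_j$ monic irreducible over $\mathbb{F}_{q^2}$, where $j\in J_0$ iff $f_j=\overline{f_j}=f_j^*$ (so $f_j=\mathrm{x}\pm1$); $j\in J_1$ iff $f_j=f_j^*\ne\overline{f_j}$; $j\in J_2$ iff $f_j=\overline{f_j}\neq f_j^*$; $j\in J_3$ iff $\overline{f_j}=f_j^*\ne f_j$; $j\in J_4$ iff $f_j,\overline{f_j},f_j^*$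 are pairwise different. Let $J=J_0\cup\dots\cup J_4$, let $\alpha_j$ be a root of $f_j$ in some extension field, and $r_j=\deg f_j$. Let $C_2$ be the group generated by $\left[\begin{smallmatrix}0&1\\1&0\end{smallmatrix}\right]$, identify $\mathbb{F}_{q^2}[C_2]$ with the algebra of the matrices $\left[\begin{smallmatrix}x&y\\y&x\end{smallmatrix}\right]$, and set - $A_j=\mathbb{F}_{q^2}\oplus\mathbb{F}_{q^2}$ if $j\in J_0$, $q$ odd; $A_j=\mathbb{F}_{q^2}[C_2]$ if $j\in J_0$, $q$ even; - $A_j=\mathcal M_2(\mathbb{F}_{q^2}(\alpha_j+\alpha_j^{-1}))\oplus\mathcal M_2(\mathbb{F}_{q^2}(\alpha_j^q+\alpha_j^{-q}))$ if $j\in J_1$; - $A_j=\mathcal M_2(\mathbb{F}_{q^2}(\alpha_j))$ if $j\in J_2\cup J_3$; - $A_j=\mathcal M_2(\mathbb{F}_{q^2}(\alpha_j))\oplus\mathcal M_2(\mathbb{F}_{q^2}(\alpha_j^q))$ if $j\in J_4$. For $\beta\neq\beta^{-1}$ let $\sigma_\beta(X)=Z^{-1}XZ$ with $Z=\left[\begin{smallmatrix}1&-\beta\\1&-\beta^{-1}\end{smallmatrix}\right]$,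 and write $\Delta_\beta=\left[\begin{smallmatrix}\beta&0\\0&\beta^{-1}\end{smallmatrix}\right]$, $S=\left[\begin{smallmatrix}0&1\\1&0\end{smallmatrix}\right]$. There is an isomorphism of $\mathbb{F}_{q^2}$-algebras $\rho=(\rho_j)_j:\mathbb{F}_{q^2}[D_n]\to\bigoplus_{j\in J}A_j$ (determined by the following values) such that - for $j\in J_0$, $q$ odd: $\rho_j(b)=(1,-1)$, and $\rho_j(a)=(1,1)$ if $f_j=\mathrm{x}-1$, $\rho_j(a)=(-1,-1)$ if $f_j=\mathrm{x}+1$; for $j\in J_0$, $q$ even: $\rho_j(a)=I$, $\rho_j(b)=S$; - for $j\in J_1$: $\rho_j(a)=\sigma_{\alpha_j}(\Delta_{\alpha_j})\oplus\sigma_{\alpha_j^q}(\Delta_{\alpha_j^q})$, $\rho_j(b)=\sigma_{\alpha_j}(S)\oplus\sigma_{\alpha_j^q}(S)$; - for $j\in J_2\cup J_3$: $\rho_j(a)=\Delta_{\alpha_j}$, $\rho_j(b)=S$; for $j\in J_4$: $\rho_j(a)=\Delta_{\alpha_j}\oplus\Delta_{\alpha_j^q}$, $\rho_j(b)=S\oplus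 S$; and the following holds. Let $\mathcal C\subseteq\mathbb{F}_{q^2}^{2n}$ be a $D_n$-code, i.e. a linear code such that for some bijection $\phi:\{1,\dots,2n\}\to D_n$ the set $I_{\mathcal C}=\{\sum_i c_i\phi(i)\mid c\in\mathcal C\}$ is a left ideal of $\mathbb{F}_{q^2}[D_n]$; fix such a $\phi$, and let $\mathcal C^{\perp_H}=\{y\mid\sum_i x_iy_i^q=0\ \forall x\in\mathcal C\}$ and $I_{\mathcal C^{\perp_H}}=\{\sum_i y_i\phi(i)\mid y\in\mathcal C^{\perp_H}\}$. Then $\rho(I_{\mathcal C})=\bigoplus_{j\in J}\mathcal I_j$ for unique left ideals $\mathcal I_j$ of $A_j$, and $\rho(I_{\mathcal C^{\perp_H}})=\bigoplus_{j\in J}\widetilde{\mathcal I}_j$ with left ideals $\widetilde{\mathcal I}_j$ of $A_j$ as follows. Here $\langle M\rangle$ is the left ideal generated by $M$. For $j\in J_1\cup J_4$ one can write $\mathcal I_j=\langle X\rangle\oplus\langle Y\rangle$, and for $j\in J_2\cup J_3$ one can write $\mathcal I_j=\langle X\rangle$, with $X,Y$ in row reduced echelon form over the respective field. Each of $X,Y$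 is then $\mathbf 0$, $I$, $E:=\left[\begin{smallmatrix}0&1\\0&0\end{smallmatrix}\right]$ or $\left[\begin{smallmatrix}1&\lambda\\0&0\end{smallmatrix}\right]$. For every such choice of $X,Y$: i) If $j\in J_0$ and $q$ is odd, $(\mathcal I_j,\widetilde{\mathcal I}_j)$ is one of $(\mathbf 0\oplus\mathbf 0,\ \mathbb{F}_{q^2}\oplus\mathbb{F}_{q^2})$, $(\mathbb{F}_{q^2}\oplus\mathbf 0,\ \mathbf 0\oplus\mathbb{F}_{q^2})$, $(\mathbf 0\oplus\mathbb{F}_{q^2},\ \mathbb{F}_{q^2}\oplus\mathbf 0)$, $(\mathbb{F}_{q^2}\oplus\mathbb{F}_{q^2},\ \mathbf 0\oplus\mathbf 0)$. ii) If $j\in J_0$ and $q$ is even, $(\mathcal I_j,\widetilde{\mathcal I}_j)$ is one of $(\mathbf 0,\ \mathbb{F}_{q^2}[C_2])$, $\left(\left\langle\left[\begin{smallmatrix}1&1\\1&1\end{smallmatrix}\right]\right\rangle,\left\langle\left[\begin{smallmatrix}1&1\\1&1\end{smallmatrix}\right]\right\rangle\right)$, $(\mathbb{F}_{q^2}[C_2],\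 \mathbf 0)$. iii) If $j\in J_1$, $\widetilde{\mathcal I}_j=\langle Y_1\rangle\oplus\langle X_1\rangle$, where $X_1=I-X$ if $X\in\{\mathbf 0,I\}$; $X_1=\left[\begin{smallmatrix}2&-(\alpha_j+\alpha_j^{-1})^q\\0&0\end{smallmatrix}\right]$ if $X=E$; $X_1=\left[\begin{smallmatrix}(2\lambda+\alpha_j+\alpha_j^{-1})^q&(-2-(\alpha_j+\alpha_j^{-1})\lambda)^q\\0&0\end{smallmatrix}\right]$ if $X=\left[\begin{smallmatrix}1&\lambda\\0&0\end{smallmatrix}\right]$; and $Y_1=I-Y$ if $Y\in\{\mathbf 0,I\}$; $Y_1=\left[\begin{smallmatrix}2&-(\alpha_j+\alpha_j^{-1})\\0&0\end{smallmatrix}\right]$ if $Y=E$; $Y_1=\left[\begin{smallmatrix}2\lambda^{q^{r_j-1}}+\alpha_j+\alpha_j^{-1}&-2-(\alpha_j+\alpha_j^{-1})\lambda^{q^{r_j-1}}\\0&0\end{smallmatrix}\right]$ if $Y=\left[\begin{smallmatrix}1&\lambda\\0&0\end{smallmatrix}\right]$. iv) If $j\in J_2$, $\widetilde{\mathcal I}_j=\langle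 X_1\rangle$, where $X_1=I-X$ if $X\in\{\mathbf 0,I\}$; $X_1=E$ if $X=E$; $X_1=\left[\begin{smallmatrix}1&-\lambda^{q^{r_j}}\\0&0\end{smallmatrix}\right]$ if $X=\left[\begin{smallmatrix}1&\lambda\\0&0\end{smallmatrix}\right]$. v) If $j\in J_3$, $\widetilde{\mathcal I}_j=\langle X_1\rangle$, where $X_1=I-X$ if $X\in\{\mathbf 0,I\}$; $X_1=\left[\begin{smallmatrix}1&0\\0&0\end{smallmatrix}\right]$ if $X=E$; $X_1=\left[\begin{smallmatrix}-\lambda^{q^{r_j}}&1\\0&0\end{smallmatrix}\right]$ if $X=\left[\begin{smallmatrix}1&\lambda\\0&0\end{smallmatrix}\right]$. vi) If $j\in J_4$, $\widetilde{\mathcal I}_j=\langle Y_1\rangle\oplus\langle X_1\rangle$, where $X_1=I-X$ if $X\in\{\mathbf 0,I\}$; $X_1=E$ if $X=E$; $X_1=\left[\begin{smallmatrix}1&-\lambda^{q}\\0&0\end{smallmatrix}\right]$ if $X=\left[\begin{smallmatrix}1&\lambda\\0&0\end{smallmatrix}\right]$; and $Y_1=I-Y$ if $Y\in\{\mathbf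 0,I\}$; $Y_1=E$ if $Y=E$; $Y_1=\left[\begin{smallmatrix}1&-\lambda^{q^{2r_j-1}}\\0&0\end{smallmatrix}\right]$ if $Y=\left[\begin{smallmatrix}1&\lambda\\0&0\end{smallmatrix}\right]$. -/

import Mathlib

open scoped IntermediateField
open Polynomial

universe u

namespace DihedralCodes

section Codes

/-- The subset `I_C = {∑ i, c i • φ i | c ∈ C}` of the group algebra `K[G]` attached to a set `C` of
words, where the bijection `φ` labels the coordinates by the elements of `G`. -/
def codeSet {K G ι : Type*} [Field K] [Fintype ι] (φ : ι ≃ G) (C : Set (ι → K)) :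
    Set (MonoidAlgebra K G) :=
  {u | ∃ c ∈ C, u = ∑ i, MonoidAlgebra.single (φ i) (c i)}

/-- The linear code `C` is a (left) `G`-code with respect to the labelling `φ`: the set `I_C` is a
left ideal of `K[G]` (`Ideal` means left ideal). -/
def IsGroupCode {K G ι : Type*} [Field K] [Group G] [Fintype ι] (φ : ι ≃ G)
    (C : Submodule K (ι → K)) : Prop :=
  ∃ I : Ideal (MonoidAlgebra K G), (I : Set (MonoidAlgebra K G)) = codeSet φ (C : Set (ι → K))

/-- The hermitian dual `{y | ∑ i, x i * (y i) ^ q = 0 for all x ∈ C}`. -/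
def hermitianDual {K ι : Type*} [Field K] [Fintype ι] (q : ℕ) (C : Set (ι → K)) : Set (ι → K) :=
  {y | ∀ x ∈ C, ∑ i, x i * y i ^ q = 0}

end Codes

section Factors

variable {K : Type u} [Field K]

/-- The conjugate polynomial: every coefficient is raised to the power `q`. -/
noncomputable def conjPoly (q : ℕ) (f : K[X]) : K[X] :=
  f.sum fun i a => monomial i (a ^ q)

/-- The (normalised) reciprocal polynomial `f(0)⁻¹ x ^ (deg f) f(x⁻¹)`. -/
noncomputable def recip (f : K[X]) : K[X] :=
  C (f.coeff 0)⁻¹ * f.reverse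

/-- The classes of irreducible factors. Class `J0` is split according to whether the
characteristic of the field is different from two (`J0odd`) or equal to two (`J0two`). -/
inductive FactorClass
  | J0odd
  | J0two
  | J1
  | J2
  | J3
  | J4

open Classical in
/-- The class of a factor `f`, with `f̄` its conjugate and `f*` its reciprocal:
`J0` iff `f = f̄ = f*`; `J1` iff `f = f* ≠ f̄`; `J2` iff `f = f̄ ≠ f*`; `J3` iff `f ≠ f* = f̄`;
`J4` iff `f`, `f̄`, `f*` are pairwise different. -/
noncomputable def factorClass (q : ℕ) (f : K[X]) : FactorClass :=
  if f = conjPoly q f ∧ f = recip f then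
    (if ringChar K = 2 then FactorClass.J0two else FactorClass.J0odd)
  else if f = recip f then FactorClass.J1
  else if f = conjPoly q f then FactorClass.J2
  else if conjPoly q f = recip f then FactorClass.J3
  else FactorClass.J4

/-- The part of `x ^ n - 1` contributed by a representative `f` of the given class. -/
noncomputable def blockPoly (q : ℕ) (f : K[X]) : FactorClass → K[X]
  | .J0odd => f
  | .J0two => f
  | .J1 => f * conjPoly q f
  | .J2 => f * recip f
  | .J3 => f * recip f
  | .J4 => f * recip f * conjPoly q f * conjPoly q (recip f)

/-- A factorisation of `x ^ n - 1` into monic irreducible polynomials, grouped in blocks that are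
closed under conjugation and reciprocation, with one representative `f j` for each block. -/
def IsBlockFactorization {J : Type*} [Fintype J] (q n : ℕ) (f : J → K[X]) : Prop :=
  (∀ j, (f j).Monic) ∧ (∀ j, Irreducible (f j)) ∧
    (X ^ n - 1 : K[X]) = ∏ j, blockPoly q (f j) (factorClass q (f j))

end Factors

section Components

variable {K L : Type u} [Field K] [Field L] [Algebra K L]

/-- The ring of two by two matrices with entries in an intermediate field. -/
abbrev M2 (F : IntermediateField K L) : Type u := Matrix (Fin 2) (Fin 2) F

/-- A matrix over an intermediate field, seen as a matrix over the big field. -/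
def toL {F : IntermediateField K L} (M : M2 F) : Matrix (Fin 2) (Fin 2) L :=
  M.map (algebraMap F L)

/-- The group algebra `K[C₂]`, where `C₂` is generated by the matrix `!![0, 1; 1, 0]`, realised as
the algebra of all matrices `!![x, y; y, x]` over `K`. -/
abbrev KC2 (K : Type u) [Field K] : Type u :=
  Algebra.adjoin K ({!![0, 1; 1, 0]} : Set (Matrix (Fin 2) (Fin 2) K))

/-- The component `A_j` attached to a factor of class `c` with root `α`. -/
abbrev Comp (K : Type u) {L : Type u} [Field K] [Field L] [Algebra K L] (q : ℕ) (α : L) :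
    FactorClass → Type u
  | .J0odd => K × K
  | .J0two => KC2 K
  | .J1 => M2 K⟮α + α⁻¹⟯ × M2 K⟮α ^ q + (α ^ q)⁻¹⟯
  | .J2 => M2 K⟮α⟯
  | .J3 => M2 K⟮α⟯
  | .J4 => M2 K⟮α⟯ × M2 K⟮α ^ q⟯

noncomputable instance instRingComp (q : ℕ) (α : L) : ∀ c : FactorClass, Ring (Comp K q α c)
  | .J0odd => inferInstanceAs (Ring (K × K))
  | .J0two => inferInstanceAs (Ring (KC2 K))
  | .J1 => inferInstanceAs (Ring (M2 K⟮α + α⁻¹⟯ × M2 K⟮α ^ q + (α ^ q)⁻¹⟯))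
  | .J2 => inferInstanceAs (Ring (M2 K⟮α⟯))
  | .J3 => inferInstanceAs (Ring (M2 K⟮α⟯))
  | .J4 => inferInstanceAs (Ring (M2 K⟮α⟯ × M2 K⟮α ^ q⟯))

noncomputable instance instAlgebraComp (q : ℕ) (α : L) :
    ∀ c : FactorClass, Algebra K (Comp K q α c)
  | .J0odd => inferInstanceAs (Algebra K (K × K))
  | .J0two => inferInstanceAs (Algebra K (KC2 K))
  | .J1 => inferInstanceAs (Algebra K (M2 K⟮α + α⁻¹⟯ × M2 K⟮α ^ q + (α ^ q)⁻¹⟯))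
  | .J2 => inferInstanceAs (Algebra K (M2 K⟮α⟯))
  | .J3 => inferInstanceAs (Algebra K (M2 K⟮α⟯))
  | .J4 => inferInstanceAs (Algebra K (M2 K⟮α⟯ × M2 K⟮α ^ q⟯))

/-- The matrix `Z` with rows `(1, -α)` and `(1, -α⁻¹)`. -/
def zMat (α : L) : Matrix (Fin 2) (Fin 2) L := !![1, -α; 1, -α⁻¹]

/-- Conjugation `X ↦ Z⁻¹ X Z` by the matrix `Z` of `α`. -/
noncomputable def sigma (α : L) (M : Matrix (Fin 2) (Fin 2) L) : Matrix (Fin 2) (Fin 2) L :=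
  (zMat α)⁻¹ * M * zMat α

open Classical in
/-- The prescribed images `A = ρ_j(a)` and `B = ρ_j(b)`, in the component of a factor `f` of the
given class with root `α`, of the generators `a` (rotation) and `b` (reflection). -/
def IsGeneratorImage (q : ℕ) (f : K[X]) (α : L) :
    ∀ c : FactorClass, Comp K q α c → Comp K q α c → Prop
  | .J0odd, A, B => A = (if f = X - 1 then ((1, 1) : K × K) else (-1, -1)) ∧ B = ((1, -1) : K × K)
  | .J0two, A, B =>
      (A : Matrix (Fin 2) (Fin 2) K) = !![1, 0; 0, 1] ∧
      (B : Matrix (Fin 2) (Fin 2) K) = !![0, 1; 1, 0]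
  | .J1, A, B =>
      (toL A.1 = sigma α !![α, 0; 0, α⁻¹] ∧
        toL A.2 = sigma (α ^ q) !![α ^ q, 0; 0, (α ^ q)⁻¹]) ∧
      (toL B.1 = sigma α !![0, 1; 1, 0] ∧ toL B.2 = sigma (α ^ q) !![0, 1; 1, 0])
  | .J2, A, B => toL A = !![α, 0; 0, α⁻¹] ∧ toL B = !![0, 1; 1, 0]
  | .J3, A, B => toL A = !![α, 0; 0, α⁻¹] ∧ toL B = !![0, 1; 1, 0]
  | .J4, A, B =>
      (toL A.1 = !![α, 0; 0, α⁻¹] ∧ toL A.2 = !![α ^ q, 0; 0, (α ^ q)⁻¹]) ∧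
      (toL B.1 = !![0, 1; 1, 0] ∧ toL B.2 = !![0, 1; 1, 0])

end Components

section Duals

/-- Row reduced echelon form: the first `r` rows have leading entries `1` in strictly increasing
columns `p 0 < p 1 < ...`, these columns vanish elsewhere, and the other rows are zero. -/
def IsRREF {m n : ℕ} {F : Type*} [Field F] (M : Matrix (Fin m) (Fin n) F) : Prop :=
  ∃ (r : ℕ) (hr : r ≤ m) (p : Fin r → Fin n), StrictMono p ∧
    (∀ i : Fin m, r ≤ (i : ℕ) → ∀ k, M i k = 0) ∧
    ∀ i : Fin r, (∀ k, k < p i → M (Fin.castLE hr i) k = 0) ∧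
      ∀ l, M l (p i) = if l = Fin.castLE hr i then 1 else 0

variable {K L : Type u} [Field K] [Field L] [Algebra K L]

open Classical in
/-- The case distinction over the four shapes of a two by two matrix `M` in row reduced echelon
form: `1 - M` if `M` is `0` or `1`, then `G` if `M = !![0, 1; 0, 0]`, and `H lam` if
`M = !![1, lam; 0, 0]`. -/
noncomputable def byShape (M G : Matrix (Fin 2) (Fin 2) L) (H : L → Matrix (Fin 2) (Fin 2) L) :
    Matrix (Fin 2) (Fin 2) L :=
  if M = 0 ∨ M = 1 then 1 - M
  else if M = !![0, 1; 0, 0] then G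
  else H (M 0 1)

/-- `I` is generated by matrices in row reduced echelon form (in classes `J1` to `J4`), and
whenever it is so written, `I'` is the left ideal with the generators given by the explicit
formulas; in class `J0`, `I` and `I'` form one of the listed pairs. Here `r` is the degree of the
factor and `α` its root. -/
def IsDualComponent (q r : ℕ) (α : L) :
    ∀ c : FactorClass, Ideal (Comp K q α c) → Ideal (Comp K q α c) → Prop
  | .J0odd, I, I' =>
      (I = Ideal.prod (⊥ : Ideal K) (⊥ : Ideal K) ∧ I' = Ideal.prod (⊤ : Ideal K) (⊤ : Ideal K)) ∨
      (I = Ideal.prod (⊤ : Ideal K) (⊥ : Ideal K) ∧ I' = Ideal.prod (⊥ : Ideal K) (⊤ : Ideal K)) ∨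
      (I = Ideal.prod (⊥ : Ideal K) (⊤ : Ideal K) ∧ I' = Ideal.prod (⊤ : Ideal K) (⊥ : Ideal K)) ∨
      (I = Ideal.prod (⊤ : Ideal K) (⊤ : Ideal K) ∧ I' = Ideal.prod (⊥ : Ideal K) (⊥ : Ideal K))
  | .J0two, I, I' =>
      (I = ⊥ ∧ I' = ⊤) ∨
      (I = Ideal.span {x : KC2 K | (x : Matrix (Fin 2) (Fin 2) K) = !![1, 1; 1, 1]} ∧
        I' = Ideal.span {x : KC2 K | (x : Matrix (Fin 2) (Fin 2) K) = !![1, 1; 1, 1]}) ∨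
      (I = ⊤ ∧ I' = ⊥)
  | .J1, I, I' =>
      (∃ X Y, IsRREF X ∧ IsRREF Y ∧ I = Ideal.prod (Ideal.span {X}) (Ideal.span {Y})) ∧
      ∀ X Y, IsRREF X → IsRREF Y → I = Ideal.prod (Ideal.span {X}) (Ideal.span {Y}) →
        ∃ Y₁ X₁, I' = Ideal.prod (Ideal.span {Y₁}) (Ideal.span {X₁}) ∧
          toL X₁ = byShape (toL X) !![2, -(α + α⁻¹) ^ q; 0, 0]
            (fun lam => !![(2 * lam + α + α⁻¹) ^ q, (-2 - (α + α⁻¹) * lam) ^ q; 0, 0]) ∧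
          toL Y₁ = byShape (toL Y) !![2, -(α + α⁻¹); 0, 0]
            (fun lam => !![2 * lam ^ q ^ (r - 1) + α + α⁻¹,
              -2 - (α + α⁻¹) * lam ^ q ^ (r - 1); 0, 0])
  | .J2, I, I' =>
      (∃ X, IsRREF X ∧ I = Ideal.span {X}) ∧
      ∀ X, IsRREF X → I = Ideal.span {X} →
        ∃ X₁, I' = Ideal.span {X₁} ∧
          toL X₁ = byShape (toL X) !![0, 1; 0, 0] (fun lam => !![1, -lam ^ q ^ r; 0, 0])
  | .J3, I, I' =>
      (∃ X, IsRREF X ∧ I = Ideal.span {X}) ∧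
      ∀ X, IsRREF X → I = Ideal.span {X} →
        ∃ X₁, I' = Ideal.span {X₁} ∧
          toL X₁ = byShape (toL X) !![1, 0; 0, 0] (fun lam => !![-lam ^ q ^ r, 1; 0, 0])
  | .J4, I, I' =>
      (∃ X Y, IsRREF X ∧ IsRREF Y ∧ I = Ideal.prod (Ideal.span {X}) (Ideal.span {Y})) ∧
      ∀ X Y, IsRREF X → IsRREF Y → I = Ideal.prod (Ideal.span {X}) (Ideal.span {Y}) →
        ∃ Y₁ X₁, I' = Ideal.prod (Ideal.span {Y₁}) (Ideal.span {X₁}) ∧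
          toL X₁ = byShape (toL X) !![0, 1; 0, 0] (fun lam => !![1, -lam ^ q; 0, 0]) ∧
          toL Y₁ = byShape (toL Y) !![0, 1; 0, 0]
            (fun lam => !![1, -lam ^ q ^ (2 * r - 1); 0, 0])

end Duals

end DihedralCodes

open DihedralCodes

namespace DihedralCodes

/-! ### Powers of Frobenius on algebraic elements over `K` -/

section Frobenius

variable {K L : Type u} [Field K] [Finite K] [Field L] [Algebra K L] {q : ℕ}

/-! Put `u† = ∑ u_g ^ q g⁻¹`. The hermitian form of `x` and `y` is the coefficient of `x y†` at `1`.
As `I_C` is a left ideal, this coefficient vanishes for all `x ∈ I_C` exactly when `x y† = 0` for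
all `x ∈ I_C` (`mem_codeSet_hermitianDual_iff`). So the dual is an annihilator condition, and it can
be computed in each block of `ρ` separately.

The map `†` is a semilinear anti-automorphism sending every group element to its inverse. In matrix
blocks it therefore has the form `z ↦ P θ(z)ᵀ Q` with `P Q = 1` and `θ` an odd power of the
`q`-Frobenius, and this only has to be checked on the two generators (`algHom_hermAdjoint`). For J2
and J3 the degree `r` is odd and `α ^ q ^ r` is `α` or `α⁻¹`, so `θ x = x ^ q ^ r` keeps the block,
with `P = Q` the swap matrix or the identity. For J1 and J4 the `q`-Frobenius exchanges the two
summands, which is why `X₁` and `Y₁` change places; in the reverse direction `θ` is the inverse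
Frobenius on the coefficient field. In J1 the representation is written in a basis over `K(α +
α⁻¹)`, and `P`, `Q` become a Gram matrix and its inverse.

A proper nonzero left ideal of a 2 by 2 matrix ring consists of the matrices whose rows are
multiples of one row `x`. Its annihilator condition says that the rows of `θ(z)` are orthogonal to
`x P`. In dimension two this means that the rows of `z` are multiples of a single row, which gives
the explicit formulas (`mem_span_iff_row_mul_eq_zero`).

To see that `ρ` is bijective, write `u = R(a) + b S(a)` with `deg R, deg S < n`. If `ρ u = 0`, each
block polynomial divides `R` and `S`; the blocks are coprime with product `x ^ n - 1`, so `u = 0`.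
The dimension of the target is at most `2n`, so injectivity suffices. -/

/-- Since `q ^ 2` is the order of a finite field, `q` is itself a power of the characteristic, so
these powers are iterates of Frobenius. -/
theorem exists_ringHom_pow (hq : Nat.card K = q ^ 2) (L : Type*) [Field L] [Algebra K L] (m : ℕ) :
    ∃ θ : L →+* L, ∀ x, θ x = x ^ q ^ m := by
  have := Fintype.ofFinite K
  obtain ⟨p, hchar, k, hk⟩ := FiniteField.card' K
  have hpp : p.Prime := hk.1
  have : CharP L p := charP_of_injective_algebraMap' K p
  have : ExpChar L p := .prime hpp
  have h2 : q ∣ p ^ (k : ℕ) := by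
    rw [← hk.2, ← Nat.card_eq_fintype_card, hq]
    exact dvd_pow_self q two_ne_zero
  obtain ⟨l, -, hl⟩ := (Nat.dvd_prime_pow hpp).1 h2
  exact ⟨iterateFrobenius L p (l * m), fun x => by rw [iterateFrobenius_def, hl, pow_mul]⟩

/-- The `q`-power map has order dividing two on `K`. Only its odd powers can induce the conjugation
in the hermitian form, so the parity of `m` matters throughout. -/
theorem algebraMap_pow_of_odd (hq : Nat.card K = q ^ 2) {m : ℕ} (hm : Odd m) (c : K) :
    algebraMap K L c ^ q ^ m = algebraMap K L (c ^ q) := by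
  have := Fintype.ofFinite K
  obtain ⟨k, rfl⟩ := hm
  rw [← map_pow, pow_succ q, pow_mul c, pow_mul, ← hq, Nat.card_eq_fintype_card,
    FiniteField.pow_card_pow]

theorem algebraMap_pow_of_even (hq : Nat.card K = q ^ 2) (s : ℕ) (c : K) :
    algebraMap K L c ^ q ^ (2 * s) = algebraMap K L c := by
  have := Fintype.ofFinite K
  rw [← map_pow, pow_mul, ← hq, Nat.card_eq_fintype_card, FiniteField.pow_card_pow]

theorem pow_pow_eq_of_mem_adjoin (hq : Nat.card K = q ^ 2) {t : L} {s : ℕ}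
    (ht : t ^ q ^ (2 * s) = t) {x : L} (hx : x ∈ K⟮t⟯) : x ^ q ^ (2 * s) = x := by
  obtain ⟨θ, hθ⟩ := exists_ringHom_pow hq L (2 * s)
  simp only [← hθ] at ht ⊢
  induction hx using IntermediateField.adjoin_induction with
  | mem y hy => rw [Set.mem_singleton_iff.1 hy, ht]
  | algebraMap c => rw [hθ, algebraMap_pow_of_even hq]
  | add a b _ _ ha hb => rw [map_add, ha, hb]
  | inv a _ ha => rw [map_inv₀, ha]
  | mul a b _ _ ha hb => rw [map_mul, ha, hb]

/-- An irreducible polynomial divides `X ^ |K| ^ s - X` exactly when its degree divides `s`. This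
turns every later question about degrees into one about Frobenius periods. -/
theorem natDegree_minpoly_dvd_iff (hq : Nat.card K = q ^ 2) {t : L} (hi : IsIntegral K t) {s : ℕ} :
    (minpoly K t).natDegree ∣ s ↔ t ^ q ^ (2 * s) = t := by
  rw [(minpoly.irreducible hi).natDegree_dvd_iff_dvd_X_pow_card_pow_sub_X, minpoly.dvd_iff, hq]
  simp [sub_eq_zero, ← pow_mul]

/-- Conjugate roots differ by an automorphism, and automorphisms of a finite field over `K` are
powers of Frobenius. As `L` may be infinite, the argument takes place in `K(α, β)`. -/
theorem exists_eq_pow_of_aeval_minpoly_eq_zero (hq : Nat.card K = q ^ 2) {α β : L}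
    (hi : IsIntegral K α) (hβ : aeval β (minpoly K α) = 0) : ∃ s, β = α ^ q ^ (2 * s) := by
  have := Fintype.ofFinite K
  have hβi : IsIntegral K β := ⟨minpoly K α, minpoly.monic hi, hβ⟩
  let N := IntermediateField.adjoin K ({α, β} : Set L)
  have hfd : FiniteDimensional K N := by
    apply IntermediateField.finiteDimensional_adjoin
    rintro x (rfl | rfl)
    · exact hi
    · exact hβi
  have : Finite N := Module.finite_of_finite K
  let a : N := ⟨α, IntermediateField.subset_adjoin K _ (by simp)⟩
  let b : N := ⟨β, IntermediateField.subset_adjoin K _ (by simp)⟩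
  have hc : IsConjRoot K a b := by
    rw [isConjRoot_iff_aeval_eq_zero (Algebra.IsIntegral.isIntegral a)]
    have h1 : minpoly K a = minpoly K α := by
      rw [← minpoly.algebraMap_eq (algebraMap N L).injective a]; rfl
    rw [h1]
    apply (algebraMap N L).injective
    rw [← aeval_algebraMap_apply, map_zero]
    exact hβ
  obtain ⟨e, he⟩ := hc.symm.exists_algEquiv
  obtain ⟨⟨i, hi⟩, h⟩ := (FiniteField.bijective_frobeniusAlgHom_pow K N).2 e.toAlgHom
  refine ⟨i, ?_⟩
  have h2 : e a = a ^ q ^ (2 * i) := by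
    have h3 : ∀ i : ℕ, (FiniteField.frobeniusAlgHom K N ^ i) a = a ^ q ^ (2 * i) := by
      intro i
      induction i with
      | zero => simp
      | succ i ih =>
        rw [pow_succ', AlgHom.mul_apply, ih, FiniteField.coe_frobeniusAlgHom,
          ← Nat.card_eq_fintype_card, hq]
        simp only [← pow_mul, mul_add, pow_add, mul_one]
    rw [← h3]
    exact (congrArg (fun g : N →ₐ[K] N => g a) h).symm
  have h4 : e a = b := by exact he
  exact congrArg (algebraMap N L) (h4.symm.trans h2)

/-- A conjugate `ε` of the `q`-th root of `α`, with `ε` either `α` or `α⁻¹`, is `α ^ q ^ r`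
with `r` the odd degree of `α`. -/
theorem pow_natDegree_eq_of_pow_conj (hq : Nat.card K = q ^ 2) {α ε : L} (hi : IsIntegral K α)
    (hε : ε = α ∨ ε = α⁻¹) (h : aeval (ε ^ q) (minpoly K α) = 0) :
    Odd (minpoly K α).natDegree ∧ α ^ q ^ (minpoly K α).natDegree = ε := by
  set r := (minpoly K α).natDegree with hr
  have hrpos : 0 < r := minpoly.natDegree_pos hi
  have hαr : α ^ q ^ (2 * r) = α := (natDegree_minpoly_dvd_iff hq hi).1 dvd_rfl
  obtain ⟨s, hs⟩ := exists_eq_pow_of_aeval_minpoly_eq_zero hq hi h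
  -- From `ε ^ q = α ^ q ^ (2s)` one wants to cancel one Frobenius; adding the period `2r` keeps the
  -- exponent positive when `s = 0`.
  obtain ⟨m, hm, hεm⟩ : ∃ m, Odd m ∧ ε = α ^ q ^ m := by
    refine ⟨2 * (s + r) - 1, ⟨s + r - 1, by omega⟩, ?_⟩
    obtain ⟨θ, hθ⟩ := exists_ringHom_pow hq L 1
    apply θ.injective
    rw [hθ, hθ, ← pow_mul, ← pow_add, pow_one, hs]
    rw [show 2 * (s + r) - 1 + 1 = 2 * r + 2 * s by omega, pow_add q, pow_mul α, hαr]
  -- The `q ^ m` power is an involution on `{α, α⁻¹}`, so `q ^ (2m)` fixes `α` and `r` divides the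
  -- odd number `m`.
  have h2 : ε ^ q ^ m = α := by
    rcases hε with h | h
    · rw [h] at hεm ⊢
      exact hεm.symm
    · have : α⁻¹ ^ q ^ m = (α ^ q ^ m)⁻¹ := inv_pow _ _
      rw [h, this, ← hεm, h, inv_inv]
  have h3 : r ∣ m := by
    rw [natDegree_minpoly_dvd_iff hq hi, two_mul, pow_add, pow_mul, ← hεm, h2]
  obtain ⟨k, rfl⟩ := h3
  obtain ⟨hro, l, rfl⟩ := Nat.odd_mul.1 hm
  refine ⟨hro, ?_⟩
  rw [hεm, show r * (2 * l + 1) = 2 * (r * l) + r by ring, pow_add, pow_mul,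
    (natDegree_minpoly_dvd_iff hq hi).1 (dvd_mul_right r l)]

/-- Write `α⁻¹ = α ^ q ^ (2s)`. Applying this power twice fixes `α`, so `2s = r k`. An even `k`
would give `α = α⁻¹`, so `k` is odd; hence `r` is even and `q ^ (r k)` acts on `α` as `q ^ r`. -/
theorem pow_natDegree_eq_inv_of_inv_conj (hq : Nat.card K = q ^ 2) {α : L} (hi : IsIntegral K α)
    (hα : α ≠ α⁻¹) (h : aeval α⁻¹ (minpoly K α) = 0) :
    Even (minpoly K α).natDegree ∧ α ^ q ^ (minpoly K α).natDegree = α⁻¹ := by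
  set r := (minpoly K α).natDegree with hr
  obtain ⟨s, hs⟩ := exists_eq_pow_of_aeval_minpoly_eq_zero hq hi h
  have h1 : α ^ q ^ (2 * (2 * s)) = α := by
    rw [two_mul (2 * s), pow_add, pow_mul, ← hs, inv_pow, ← hs, inv_inv]
  obtain ⟨k, hk⟩ := (natDegree_minpoly_dvd_iff hq hi).2 h1
  rw [← hr] at hk
  rcases Nat.even_or_odd k with ⟨l, hl⟩ | ⟨l, hl⟩
  · exfalso
    apply hα
    rw [hs]
    symm
    rw [← natDegree_minpoly_dvd_iff hq hi]
    refine ⟨l, ?_⟩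
    rw [← hr]
    linarith [hl ▸ hk, mul_add r l l]
  · constructor
    · have : Even (r * k) := ⟨s, by omega⟩
      rw [Nat.even_mul] at this
      rcases this with h | h
      · exact h
      · rw [hl] at h; simp [parity_simps] at h
    · rw [hs, hk, hl, show r * (2 * l + 1) = 2 * (r * l) + r by ring, pow_add, pow_mul,
        (natDegree_minpoly_dvd_iff hq hi).1 (dvd_mul_right r l)]

theorem adjoin_pow_eq_adjoin (hq : Nat.card K = q ^ 2) {t : L} (hi : IsIntegral K t) :
    K⟮t ^ q⟯ = K⟮t⟯ := by
  apply le_antisymm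
  · rw [IntermediateField.adjoin_simple_le_iff]
    exact pow_mem (IntermediateField.mem_adjoin_simple_self K t) q
  · rw [IntermediateField.adjoin_simple_le_iff]
    have hpos : 0 < (minpoly K t).natDegree := minpoly.natDegree_pos hi
    have h : t ^ q ^ (2 * (minpoly K t).natDegree) = t :=
      (natDegree_minpoly_dvd_iff hq hi).1 dvd_rfl
    rw [show 2 * (minpoly K t).natDegree = (2 * (minpoly K t).natDegree - 1) + 1 by omega,
      pow_succ', pow_mul] at h
    nth_rewrite 2 [← h]
    exact pow_mem (IntermediateField.mem_adjoin_simple_self K _) _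

omit [Finite K] in
theorem adjoin_inv_eq_adjoin (α : L) : K⟮α⁻¹⟯ = K⟮α⟯ := by
  apply le_antisymm <;> rw [IntermediateField.adjoin_simple_le_iff]
  · exact inv_mem (IntermediateField.mem_adjoin_simple_self K α)
  · simpa using inv_mem (IntermediateField.mem_adjoin_simple_self K α⁻¹)

omit [Finite K] in
-- Comparing degrees identifies conjugate and reciprocal polynomials as minimal polynomials without
-- proving them irreducible first.
theorem eq_minpoly_of_adjoin_eq {α β : L} {g : K[X]} (hi : IsIntegral K α) (h : K⟮β⟯ = K⟮α⟯)
    (hg : g.Monic) (hdeg : g.natDegree = (minpoly K α).natDegree) (h0 : aeval β g = 0) :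
    g = minpoly K β := by
  have hβ : IsIntegral K β := ⟨g, hg, h0⟩
  apply Polynomial.eq_of_monic_of_dvd_of_natDegree_le (minpoly.monic hβ) hg (minpoly.dvd K β h0)
  rw [hdeg, ← IntermediateField.adjoin.finrank hi, ← h, IntermediateField.adjoin.finrank hβ]

end Frobenius

/-! ### Conjugate and reciprocal polynomials -/

section Polynomials

variable {K L : Type u} [Field K] [Finite K] [Field L] [Algebra K L] {q : ℕ}

theorem exists_conjPoly_eq_map (hq : Nat.card K = q ^ 2) :
    ∃ θ : K →+* K, (∀ x, θ x = x ^ q) ∧ ∀ f : K[X], conjPoly q f = f.map θ := by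
  obtain ⟨θ, hθ⟩ := exists_ringHom_pow hq K 1
  refine ⟨θ, by simpa using hθ, fun f => ?_⟩
  simp only [pow_one] at hθ
  simp only [conjPoly, Polynomial.map, eval₂_eq_sum, RingHom.comp_apply, hθ,
    C_mul_X_pow_eq_monomial]

theorem monic_conjPoly (hq : Nat.card K = q ^ 2) {f : K[X]} (hf : f.Monic) :
    (conjPoly q f).Monic := by
  obtain ⟨θ, -, h⟩ := exists_conjPoly_eq_map hq
  rw [h]; exact hf.map θ

theorem natDegree_conjPoly (hq : Nat.card K = q ^ 2) (f : K[X]) :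
    (conjPoly q f).natDegree = f.natDegree := by
  obtain ⟨θ, -, h⟩ := exists_conjPoly_eq_map hq
  rw [h, natDegree_map]

theorem aeval_conjPoly (hq : Nat.card K = q ^ 2) {f : K[X]} {α : L} (h : aeval α f = 0) :
    aeval (α ^ q) (conjPoly q f) = 0 := by
  obtain ⟨θ, hθ, hf⟩ := exists_conjPoly_eq_map hq
  obtain ⟨τ, hτ⟩ := exists_ringHom_pow hq L 1
  simp only [pow_one] at hτ
  have h2 := congrArg τ h
  rw [aeval_def, hom_eval₂, map_zero, hτ] at h2
  rw [hf, aeval_def, eval₂_map, ← h2]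
  congr 1
  ext c
  simp [hθ, hτ]

omit [Finite K] in
theorem natDegree_recip {f : K[X]} (h0 : f.coeff 0 ≠ 0) :
    (recip f).natDegree = f.natDegree := by
  rw [recip, natDegree_C_mul (inv_ne_zero h0), reverse_natDegree,
    natTrailingDegree_eq_zero.2 (Or.inr h0), Nat.sub_zero]

omit [Finite K] in
theorem monic_recip {f : K[X]} (h0 : f.coeff 0 ≠ 0) : (recip f).Monic := by
  rw [Monic, recip, leadingCoeff_mul, leadingCoeff_C, reverse_leadingCoeff, trailingCoeff,
    natTrailingDegree_eq_zero.2 (Or.inr h0), inv_mul_cancel₀ h0]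

omit [Finite K] in
theorem aeval_recip {f : K[X]} {α : L} (hα : α ≠ 0) (h : aeval α f = 0) :
    aeval α⁻¹ (recip f) = 0 := by
  have : Invertible α := invertibleOfNonzero hα
  rw [recip, map_mul, ← invOf_eq_inv]
  have := (eval₂_reverse_eq_zero_iff (algebraMap K L) α f).2 h
  rw [aeval_def (x := ⅟α) (p := f.reverse), this, mul_zero]

end Polynomials

end DihedralCodes

namespace DihedralCodes

/-! ### The hermitian dual as an annihilator -/

section Adjoint

variable {K G : Type*} [Field K] [Group G] [Finite G]

/-- The adjoint `∑ u_g ^ q g⁻¹` of the element `∑ u_g g` of the group algebra. -/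
noncomputable def hermAdjoint (q : ℕ) (u : MonoidAlgebra K G) : MonoidAlgebra K G :=
  .ofCoeff (Finsupp.equivFunOnFinite.symm fun g => u.coeff g⁻¹ ^ q)

theorem coeff_hermAdjoint (q : ℕ) (u : MonoidAlgebra K G) (g : G) :
    (hermAdjoint q u).coeff g = u.coeff g⁻¹ ^ q := rfl

theorem hermAdjoint_single {q : ℕ} (hq0 : q ≠ 0) (g : G) (c : K) :
    hermAdjoint q (MonoidAlgebra.single g c) = MonoidAlgebra.single g⁻¹ (c ^ q) := by
  classical
  ext h
  rw [coeff_hermAdjoint, MonoidAlgebra.coeff_single, MonoidAlgebra.coeff_single,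
    Finsupp.single_apply, Finsupp.single_apply]
  by_cases hg : g = h⁻¹
  · rw [if_pos hg, if_pos (by rw [hg, inv_inv])]
  · rw [if_neg hg, if_neg (fun h' => hg (by rw [← h', inv_inv])), zero_pow hq0]

theorem hermAdjoint_add {q : ℕ} (hadd : ∀ x y : K, (x + y) ^ q = x ^ q + y ^ q)
    (u v : MonoidAlgebra K G) : hermAdjoint q (u + v) = hermAdjoint q u + hermAdjoint q v := by
  ext g
  simp [coeff_hermAdjoint, hadd]

theorem coeff_one_mul_hermAdjoint [Fintype G] {q : ℕ} (x y : MonoidAlgebra K G) :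
    (x * hermAdjoint q y).coeff 1 = ∑ g, x.coeff g * y.coeff g ^ q := by
  rw [MonoidAlgebra.coeff_mul_apply_left, Finsupp.sum_fintype _ _ (by simp)]
  simp [coeff_hermAdjoint]

omit [Group G] [Finite G] in
theorem coeff_sum_single_equiv {ι : Type*} [Fintype ι] (φ : ι ≃ G) (c : ι → K) (i : ι) :
    (∑ k, MonoidAlgebra.single (φ k) (c k) : MonoidAlgebra K G).coeff (φ i) = c i := by
  classical
  rw [MonoidAlgebra.coeff_sum, Finsupp.finsetSum_apply]
  simp [Finsupp.single_apply]

omit [Group G] [Finite G] in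
theorem mem_codeSet {ι : Type*} [Fintype ι] (φ : ι ≃ G) (C : Set (ι → K))
    (u : MonoidAlgebra K G) : u ∈ codeSet φ C ↔ (fun i => u.coeff (φ i)) ∈ C := by
  constructor
  · rintro ⟨c, hc, rfl⟩
    simpa only [coeff_sum_single_equiv] using hc
  · intro h
    refine ⟨_, h, ?_⟩
    ext g
    obtain ⟨i, rfl⟩ := φ.surjective g
    exact (coeff_sum_single_equiv φ (fun i => u.coeff (φ i)) i).symm

/-- The coefficient of `x y†` at `g` is the coefficient of `(g⁻¹ x) y†` at `1`, and `g⁻¹ x` stays in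
the left ideal. -/
theorem mem_codeSet_hermitianDual_iff {ι : Type*} [Fintype ι] {q : ℕ} {φ : ι ≃ G}
    {C : Submodule K (ι → K)} (hC : IsGroupCode φ C) (y : MonoidAlgebra K G) :
    y ∈ codeSet φ (hermitianDual q (C : Set (ι → K))) ↔
      ∀ x ∈ codeSet φ (C : Set (ι → K)), x * hermAdjoint q y = 0 := by
  have := Fintype.ofFinite G
  obtain ⟨I, hI⟩ := hC
  have hsum : ∀ x : MonoidAlgebra K G, (x * hermAdjoint q y).coeff 1 =
      ∑ i, x.coeff (φ i) * y.coeff (φ i) ^ q := by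
    intro x
    rw [coeff_one_mul_hermAdjoint, ← Equiv.sum_comp φ]
  rw [mem_codeSet]
  constructor
  · intro h x hx
    ext g
    have hgx : MonoidAlgebra.single g⁻¹ 1 * x ∈ codeSet φ (C : Set (ι → K)) := by
      rw [← hI] at hx ⊢
      exact I.mul_mem_left _ hx
    have h1 := h _ ((mem_codeSet φ _ _).1 hgx)
    rw [← hsum, mul_assoc, MonoidAlgebra.coeff_single_mul_apply] at h1
    simpa using h1
  · intro h c hc
    have hx : (∑ i, MonoidAlgebra.single (φ i) (c i) : MonoidAlgebra K G) ∈
        codeSet φ (C : Set (ι → K)) := ⟨c, hc, rfl⟩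
    have h1 := hsum (∑ i, MonoidAlgebra.single (φ i) (c i))
    rw [h _ hx] at h1
    simp only [coeff_sum_single_equiv] at h1
    exact h1.symm

end Adjoint

/-! ### Representations of the dihedral group and the adjoint -/

section Dihedral

open DihedralGroup

theorem dihedral_induction {n : ℕ} [NeZero n] {p : DihedralGroup n → Prop} (h1 : p 1)
    (hr : p (r 1)) (hs : p (sr 0)) (hmul : ∀ g h, p g → p h → p (g * h)) (g : DihedralGroup n) :
    p g := by
  have hpow : ∀ k : ℕ, p (r 1 ^ k) := by
    intro k
    induction k with
    | zero => simpa using h1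
    | succ k ih => rw [pow_succ]; exact hmul _ _ ih hr
  have hri : ∀ i : ZMod n, p (r i) := by
    intro i
    have := hpow i.val
    rwa [r_one_pow, ZMod.natCast_zmod_val] at this
  cases g with
  | r i => exact hri i
  | sr i =>
    have := hmul _ _ hs (hri i)
    rwa [sr_mul_r, zero_add] at this

variable {K A : Type*} [Field K] [Ring A] [Algebra K A] {n : ℕ} [NeZero n]

/-- The relation `bab = a⁻¹` is used in the inverse-free form `aba = b`; the group element `sr i`
plays the role of `b a ^ i`. -/
theorem exists_algHom_dihedral (a b : A) (ha : a ^ n = 1) (hb : b * b = 1) (hab : a * b * a = b) :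
    ∃ Φ : MonoidAlgebra K (DihedralGroup n) →ₐ[K] A,
      Φ (MonoidAlgebra.of K _ (r 1)) = a ∧ Φ (MonoidAlgebra.of K _ (sr 0)) = b := by
  have hadd : ∀ i j : ZMod n, a ^ (i + j).val = a ^ i.val * a ^ j.val := by
    intro i j
    rw [ZMod.val_add, ← pow_add, ← pow_mod_orderOf, Nat.mod_mod_of_dvd _ (orderOf_dvd_of_pow_eq_one ha),
      pow_mod_orderOf]
  have hpow : ∀ k : ℕ, a ^ k * b * a ^ k = b := by
    intro k
    induction k with
    | zero => simp
    | succ k ih =>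
      nth_rewrite 1 [pow_succ]
      rw [mul_assoc (a ^ k), pow_succ' a k, ← mul_assoc, mul_assoc (a ^ k), hab, ih]
  have hsub : ∀ i j : ZMod n, a ^ i.val * (b * a ^ j.val) = b * a ^ (j - i).val := by
    intro i j
    have h : j = i + (j - i) := by ring
    nth_rewrite 1 [h]
    rw [hadd, ← mul_assoc, ← mul_assoc, hpow]
  let F : DihedralGroup n →* A :=
    { toFun := fun g => match g with
        | r i => a ^ i.val
        | sr i => b * a ^ i.val
      map_one' := by
        change a ^ (0 : ZMod n).val = 1
        simp
      map_mul' := by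
        rintro (i | i) (j | j)
        · exact hadd i j
        · exact (hsub i j).symm
        · change b * a ^ (i + j).val = b * a ^ i.val * a ^ j.val
          rw [hadd, mul_assoc]
        · change a ^ (j - i).val = b * a ^ i.val * (b * a ^ j.val)
          rw [mul_assoc, hsub, ← mul_assoc, hb, one_mul] }
  refine ⟨MonoidAlgebra.lift K A _ F, ?_, ?_⟩
  · rw [MonoidAlgebra.lift_of]
    -- For `n = 1` the exponent is `0`, and `a ^ n = 1` makes up for the difference.
    change a ^ (1 : ZMod n).val = a
    rw [ZMod.val_one_eq_one_mod, ← pow_mod_orderOf,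
      Nat.mod_mod_of_dvd _ (orderOf_dvd_of_pow_eq_one ha), pow_mod_orderOf, pow_one]
  · rw [MonoidAlgebra.lift_of]
    change b * a ^ (0 : ZMod n).val = b
    simp

/-- The condition `Ψ(g) T(Φ(g)) = 1` passes to products because `T` reverses them: the inner pair
cancels first. Two homomorphisms are needed because the adjoint may relate different summands. -/
theorem algHom_hermAdjoint {B : Type*} [Ring B] [Algebra K B] {q : ℕ} (hq0 : q ≠ 0)
    (hadd : ∀ x y : K, (x + y) ^ q = x ^ q + y ^ q)
    (Φ : MonoidAlgebra K (DihedralGroup n) →ₐ[K] A) (Ψ : MonoidAlgebra K (DihedralGroup n) →ₐ[K] B)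
    (T : A →+ B) (hT1 : T 1 = 1) (hTmul : ∀ x y, T (x * y) = T y * T x)
    (hTK : ∀ (c : K) x, T (c • x) = c ^ q • T x)
    (ha : Ψ (MonoidAlgebra.of K _ (r 1)) * T (Φ (MonoidAlgebra.of K _ (r 1))) = 1)
    (hb : Ψ (MonoidAlgebra.of K _ (sr 0)) * T (Φ (MonoidAlgebra.of K _ (sr 0))) = 1)
    (u : MonoidAlgebra K (DihedralGroup n)) : Ψ (hermAdjoint q u) = T (Φ u) := by
  have hg : ∀ g, Ψ (MonoidAlgebra.of K _ g) * T (Φ (MonoidAlgebra.of K _ g)) = 1 := by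
    intro g
    induction g using dihedral_induction with
    | h1 => rw [map_one, map_one, map_one, hT1, mul_one]
    | hr => exact ha
    | hs => exact hb
    | hmul g h hg hh =>
      rw [map_mul, map_mul, map_mul, hTmul, mul_assoc, ← mul_assoc (Ψ _) (T _), hh, one_mul, hg]
  have hg' : ∀ g, Ψ (MonoidAlgebra.of K _ g⁻¹) = T (Φ (MonoidAlgebra.of K _ g)) := by
    intro g
    rw [← mul_one (Ψ _), ← hg g, ← mul_assoc, ← map_mul, ← map_mul, inv_mul_cancel, map_one,
      map_one, one_mul]
  induction u using MonoidAlgebra.induction_linear with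
  | zero =>
    have : hermAdjoint q (0 : MonoidAlgebra K (DihedralGroup n)) = 0 := by
      ext g
      simp [coeff_hermAdjoint, hq0]
    simp [this]
  | add u v hu hv => rw [hermAdjoint_add hadd, map_add, map_add, map_add, hu, hv]
  | single g c =>
    have h1 : ∀ (g : DihedralGroup n) (c : K),
        MonoidAlgebra.single g c = c • MonoidAlgebra.of K _ g := by
      intro g c
      simp [MonoidAlgebra.of_apply]
    rw [hermAdjoint_single hq0, h1, h1, map_smul, map_smul, hTK, hg']

theorem algHom_hermAdjoint_matrix {L ι : Type*} [Field L] [Algebra K L] [Fintype ι] [DecidableEq ι]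
    {q : ℕ} (hq0 : q ≠ 0)
    (hadd : ∀ x y : K, (x + y) ^ q = x ^ q + y ^ q)
    (Φ Ψ : MonoidAlgebra K (DihedralGroup n) →ₐ[K] Matrix ι ι L)
    (θ : L →+* L) (hθ : ∀ c : K, θ (algebraMap K L c) = algebraMap K L (c ^ q))
    (P Q : Matrix ι ι L) (hPQ : P * Q = 1)
    (ha : Ψ (MonoidAlgebra.of K _ (r 1)) *
      (P * ((Φ (MonoidAlgebra.of K _ (r 1))).map θ).transpose * Q) = 1)
    (hb : Ψ (MonoidAlgebra.of K _ (sr 0)) *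
      (P * ((Φ (MonoidAlgebra.of K _ (sr 0))).map θ).transpose * Q) = 1)
    (u : MonoidAlgebra K (DihedralGroup n)) :
    Ψ (hermAdjoint q u) = P * ((Φ u).map θ).transpose * Q := by
  have hQP : Q * P = 1 := mul_eq_one_comm.1 hPQ
  let T : Matrix ι ι L →+ Matrix ι ι L :=
    { toFun := fun z => P * (z.map θ).transpose * Q
      map_zero' := by simp
      map_add' := by
        intro x y
        rw [Matrix.map_add _ (map_add θ), Matrix.transpose_add, mul_add, add_mul] }
  refine algHom_hermAdjoint hq0 hadd Φ Ψ T ?_ ?_ ?_ ha hb u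
  · change P * ((1 : Matrix ι ι L).map θ).transpose * Q = 1
    rw [Matrix.map_one _ (map_zero θ) (map_one θ), Matrix.transpose_one, mul_one, hPQ]
  · intro x y
    change P * ((x * y).map θ).transpose * Q =
      P * (y.map θ).transpose * Q * (P * (x.map θ).transpose * Q)
    rw [Matrix.map_mul, Matrix.transpose_mul]
    simp only [← mul_assoc]
    rw [mul_assoc _ Q P, hQP, mul_one]
  · intro c x
    change P * ((c • x).map θ).transpose * Q = c ^ q • (P * (x.map θ).transpose * Q)
    have : (c • x).map θ = c ^ q • x.map θ := by
      ext i j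
      rw [Matrix.map_apply, Matrix.smul_apply, Matrix.smul_apply, Matrix.map_apply,
        Algebra.smul_def, Algebra.smul_def, map_mul, hθ]
    rw [this, Matrix.transpose_smul, Matrix.mul_smul, Matrix.smul_mul]

end Dihedral

end DihedralCodes

namespace DihedralCodes

/-! ### Left ideals of 2 by 2 matrix rings -/

section TwoByTwo

variable {F : Type*} [Field F]

theorem isRREF_zero : IsRREF (0 : Matrix (Fin 2) (Fin 2) F) :=
  ⟨0, by omega, Fin.elim0, fun i => i.elim0, fun _ _ _ => rfl, fun i => i.elim0⟩

theorem isRREF_one : IsRREF (1 : Matrix (Fin 2) (Fin 2) F) := by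
  refine ⟨2, le_rfl, id, strictMono_id, fun i hi => absurd i.2 (by omega), fun i => ⟨?_, ?_⟩⟩
  · intro k hk
    exact Matrix.one_apply_ne (ne_of_gt hk)
  · intro l
    simp [Matrix.one_apply]

theorem isRREF_second : IsRREF (!![0, 1; 0, 0] : Matrix (Fin 2) (Fin 2) F) := by
  refine ⟨1, by omega, fun _ => 1, Subsingleton.strictMono _, ?_, ?_⟩
  · intro i hi k
    fin_cases i
    · simp at hi
    · fin_cases k <;> rfl
  · intro i
    fin_cases i
    constructor
    · intro k hk
      fin_cases k
      · rfl
      · simp at hk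
    · intro l
      fin_cases l <;> simp

theorem isRREF_first (a : F) : IsRREF !![1, a; 0, 0] := by
  refine ⟨1, by omega, fun _ => 0, Subsingleton.strictMono _, ?_, ?_⟩
  · intro i hi k
    fin_cases i
    · simp at hi
    · fin_cases k <;> rfl
  · intro i
    fin_cases i
    constructor
    · intro k hk
      simp at hk
    · intro l
      fin_cases l <;> simp

theorem isRREF_two_iff {M : Matrix (Fin 2) (Fin 2) F} :
    IsRREF M ↔ M = 0 ∨ M = 1 ∨ M = !![0, 1; 0, 0] ∨ ∃ a, M = !![1, a; 0, 0] := by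
  constructor
  · rintro ⟨r, hr, p, hp, h0, h1⟩
    interval_cases r
    · left
      ext i k
      exact h0 i (Nat.zero_le _) k
    · right; right
      have h10 := h0 1 (by simp)
      obtain ⟨hlt, hcol⟩ := h1 0
      have hc0 := hcol 0
      rcases Fin.exists_fin_two.1 ⟨p 0, rfl⟩ with hp0 | hp0
      · right
        refine ⟨M 0 1, ?_⟩
        rw [hp0] at hc0
        ext i k
        fin_cases i <;> fin_cases k <;> simp_all
      · left
        rw [hp0] at hc0 hlt
        have := hlt 0 (by simp)
        ext i k
        fin_cases i <;> fin_cases k <;> simp_all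
    · right; left
      have hp01 : p 0 < p 1 := hp (by simp)
      have e0 : p 0 = 0 := by omega
      have e1 : p 1 = 1 := by omega
      have c0 := (h1 0).2
      have c1 := (h1 1).2
      rw [e0] at c0
      rw [e1] at c1
      ext i k
      fin_cases k
      · simpa [Matrix.one_apply] using c0 i
      · simpa [Matrix.one_apply] using c1 i
  · rintro (rfl | rfl | rfl | ⟨a, rfl⟩)
    · exact isRREF_zero
    · exact isRREF_one
    · exact isRREF_second
    · exact isRREF_first a

/-- Left multiples of a matrix with one nonzero row have all their rows proportional to it;
proportionality is stated as a vanishing determinant. -/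
theorem mem_span_row_iff {x y : F} (h : x ≠ 0 ∨ y ≠ 0) (z : Matrix (Fin 2) (Fin 2) F) :
    z ∈ Ideal.span {!![x, y; 0, 0]} ↔ z 0 0 * y = z 0 1 * x ∧ z 1 0 * y = z 1 1 * x := by
  obtain ⟨a, b, c, d, rfl⟩ : ∃ a b c d, z = !![a, b; c, d] := ⟨_, _, _, _, Matrix.eta_fin_two z⟩
  rw [Ideal.mem_span_singleton']
  constructor
  · rintro ⟨w, hw⟩
    rw [Matrix.eta_fin_two w, Matrix.mul_fin_two] at hw
    simp only [mul_zero, add_zero] at hw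
    rw [← hw]
    simp only [Matrix.of_apply, Matrix.cons_val', Matrix.cons_val_zero, Matrix.cons_val_one,
      Matrix.cons_val_fin_one]
    constructor <;> ring
  · simp only [Matrix.of_apply, Matrix.cons_val', Matrix.cons_val_zero, Matrix.cons_val_one,
      Matrix.cons_val_fin_one]
    rintro ⟨h0, h1⟩
    rcases h with h | h
    · refine ⟨!![a * x⁻¹, 0; c * x⁻¹, 0], ?_⟩
      rw [Matrix.mul_fin_two]
      simp only [mul_zero, add_zero, mul_right_comm _ _ y, h0, h1,
        mul_inv_cancel_right₀ h, inv_mul_cancel_right₀ h]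
    · refine ⟨!![b * y⁻¹, 0; d * y⁻¹, 0], ?_⟩
      rw [Matrix.mul_fin_two]
      simp only [mul_zero, add_zero, mul_right_comm _ _ x, ← h0, ← h1,
        mul_inv_cancel_right₀ h, inv_mul_cancel_right₀ h]

/-- Every left ideal of the ring of two by two matrices over a field is generated by a matrix in
row reduced echelon form. -/
theorem exists_isRREF_span_eq (I : Ideal (Matrix (Fin 2) (Fin 2) F)) :
    ∃ X, IsRREF X ∧ I = Ideal.span {X} := by
  by_cases hbot : I = ⊥
  · exact ⟨0, isRREF_zero, by rw [hbot, Ideal.span_singleton_eq_bot.2 rfl]⟩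
  by_cases hdet : ∃ z ∈ I, z.det ≠ 0
  · obtain ⟨z, hz, hd⟩ := hdet
    refine ⟨1, isRREF_one, ?_⟩
    rw [Ideal.span_singleton_one, Ideal.eq_top_iff_one, ← Matrix.nonsing_inv_mul z (Ne.isUnit hd)]
    exact I.mul_mem_left _ hz
  push Not at hdet
  obtain ⟨w, hw, hw0⟩ := Submodule.exists_mem_ne_zero_of_ne_bot hbot
  obtain ⟨x, y, hxy, hI⟩ : ∃ x y : F, (x ≠ 0 ∨ y ≠ 0) ∧ !![x, y; 0, 0] ∈ I := by
    by_cases h : w 0 0 ≠ 0 ∨ w 0 1 ≠ 0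
    · refine ⟨w 0 0, w 0 1, h, ?_⟩
      convert I.mul_mem_left !![1, 0; 0, 0] hw using 1
      ext i k
      fin_cases i <;> fin_cases k <;> simp [Matrix.mul_apply, Fin.sum_univ_two]
    · refine ⟨w 1 0, w 1 1, ?_, ?_⟩
      · by_contra h'
        push Not at h h'
        apply hw0
        ext i k
        fin_cases i <;> fin_cases k <;> simp [h, h']
      · convert I.mul_mem_left !![0, 1; 0, 0] hw using 1
        ext i k
        fin_cases i <;> fin_cases k <;> simp [Matrix.mul_apply, Fin.sum_univ_two]
  have hspan : I = Ideal.span {!![x, y; 0, 0]} := by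
    apply le_antisymm
    · intro z hz
      obtain ⟨a, b, c, d, rfl⟩ : ∃ a b c d, z = !![a, b; c, d] :=
        ⟨_, _, _, _, Matrix.eta_fin_two z⟩
      rw [mem_span_row_iff hxy]
      constructor
      -- The ideal contains the row `(x, y)` stacked on any row of `z`; as it has no invertible
      -- element, that determinant vanishes.
      · have := hdet _ (I.add_mem hI (I.mul_mem_left !![0, 0; 1, 0] hz))
        rw [Matrix.mul_fin_two, Matrix.det_fin_two] at this
        simp at this ⊢
        linear_combination -this
      · have := hdet _ (I.add_mem hI (I.mul_mem_left !![0, 0; 0, 1] hz))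
        rw [Matrix.mul_fin_two, Matrix.det_fin_two] at this
        simp at this ⊢
        linear_combination -this
    · rw [Ideal.span_singleton_le_iff_mem]
      exact hI
  by_cases hx : x = 0
  · refine ⟨!![0, 1; 0, 0], isRREF_second, ?_⟩
    have hy : y ≠ 0 := by simpa [hx] using hxy
    rw [hspan]
    ext z
    rw [mem_span_row_iff hxy, mem_span_row_iff (Or.inr one_ne_zero)]
    simp [hx, hy]
  · refine ⟨!![1, y * x⁻¹; 0, 0], isRREF_first _, ?_⟩
    rw [hspan]
    ext z
    rw [mem_span_row_iff hxy, mem_span_row_iff (Or.inl one_ne_zero)]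
    field_simp

end TwoByTwo

/-! ### Annihilators under `z ↦ P θ(z)ᵀ Q` -/

section DualGenerator

variable {K L : Type u} [Field K] [Field L] [Algebra K L] {F₁ F : IntermediateField K L}

theorem toL_injective : Function.Injective (toL : M2 F → Matrix (Fin 2) (Fin 2) L) :=
  Matrix.map_injective (algebraMap F L).injective

@[simp]
theorem toL_apply (z : M2 F) (i k : Fin 2) : toL z i k = (z i k : L) := rfl

theorem toL_mul (x y : M2 F) : toL (x * y) = toL x * toL y := Matrix.map_mul

@[simp]
theorem toL_zero : toL (0 : M2 F) = 0 := Matrix.map_zero _ (map_zero _)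

@[simp]
theorem toL_one : toL (1 : M2 F) = 1 := Matrix.map_one _ (map_zero _) (map_one _)

theorem toL_of (a b c d : F) : toL !![a, b; c, d] = !![(a : L), b; c, d] := by
  ext i k
  fin_cases i <;> fin_cases k <;> rfl

/-- `M` has rows `y` and `0`, with `y` over `F`, and `θ y` is orthogonal to `(x₀, x₁) * P` up to
swapping and sign. -/
def IsDualRow (F : IntermediateField K L) (θ : L →+* L) (P : Matrix (Fin 2) (Fin 2) L) (x₀ x₁ : L)
    (M : Matrix (Fin 2) (Fin 2) L) : Prop :=
  ∃ y₀ y₁ : F, ∃ c : L, c ≠ 0 ∧ M = !![(y₀ : L), y₁; 0, 0] ∧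
    x₀ * P 0 0 + x₁ * P 1 0 = c * θ y₁ ∧ x₀ * P 0 1 + x₁ * P 1 1 = -(c * θ y₀)

/-- Cancelling `Q`, the right side says that `(x₀, x₁) P = c (θ y₁, -θ y₀)` is orthogonal to the
rows of `θ(z)`. Up to `c` this is `θ` applied to the determinants expressing that the rows of `z`
are proportional to `(y₀, y₁)`. -/
theorem mem_span_iff_row_mul_eq_zero {θ : L →+* L} {P Q : Matrix (Fin 2) (Fin 2) L}
    (hPQ : P * Q = 1) {x₀ x₁ : F₁} (hx : x₀ ≠ 0 ∨ x₁ ≠ 0) {y₀ y₁ : F} {c : L} (hc : c ≠ 0)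
    (h0 : x₀ * P 0 0 + x₁ * P 1 0 = c * θ y₁) (h1 : x₀ * P 0 1 + x₁ * P 1 1 = -(c * θ y₀))
    {z : M2 F} {z' : M2 F₁} (hz : toL z' = P * ((toL z).map θ).transpose * Q) :
    z ∈ Ideal.span {!![y₀, y₁; 0, 0]} ↔ !![x₀, x₁; 0, 0] * z' = 0 := by
  have hQP : Q * P = 1 := mul_eq_one_comm.1 hPQ
  have hXP : toL !![x₀, x₁; 0, 0] * P = !![c * θ y₁, -(c * θ y₀); 0, 0] := by
    rw [toL_of, ← h0, ← h1]
    ext i k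
    fin_cases i <;> fin_cases k <;> simp [Matrix.mul_apply, Fin.sum_univ_two]
  -- Invertibility of `P` carries the nonvanishing of `x` over to `y`.
  have hy : y₀ ≠ 0 ∨ y₁ ≠ 0 := by
    by_contra h
    push Not at h
    have h2 : toL !![x₀, x₁; 0, 0] = 0 := by
      rw [← mul_one (toL _), ← hPQ, ← mul_assoc, hXP, h.1, h.2]
      ext i k
      fin_cases i <;> fin_cases k <;> simp [Matrix.mul_apply, Fin.sum_univ_two]
    rw [← toL_zero (F := F₁)] at h2
    have h3 := toL_injective h2
    have e0 : x₀ = 0 := congrFun (congrFun h3 0) 0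
    have e1 : x₁ = 0 := congrFun (congrFun h3 0) 1
    exact hx.elim (fun h => h e0) (fun h => h e1)
  have hcomp : ∀ a b : F, a * y₁ = b * y₀ ↔ c * θ y₁ * θ a + -(c * θ y₀) * θ b = 0 := by
    intro a b
    rw [← (algebraMap F L).injective.eq_iff, ← θ.injective.eq_iff, ← sub_eq_zero]
    simp only [IntermediateField.algebraMap_apply, map_mul]
    rw [show c * θ y₁ * θ a + -(c * θ y₀) * θ b = c * (θ a * θ y₁ - θ b * θ y₀) by ring,
      mul_eq_zero, or_iff_right hc]
  rw [mem_span_row_iff hy, hcomp, hcomp, ← toL_injective.eq_iff, toL_mul, hz, toL_zero,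
    ← mul_assoc, ← mul_assoc, hXP]
  constructor
  · rintro ⟨e0, e1⟩
    convert zero_mul Q
    ext i k
    fin_cases i <;> fin_cases k <;> simp [Matrix.mul_apply, Fin.sum_univ_two]
    · simpa using e0
    · simpa using e1
  · intro h
    have h2 := congrArg (· * P) h
    simp only [mul_assoc _ Q P, hQP, mul_one, zero_mul] at h2
    have e0 := congrFun (congrFun h2 0) 0
    have e1 := congrFun (congrFun h2 0) 1
    simp [Matrix.mul_apply, Fin.sum_univ_two] at e0 e1
    exact ⟨by simpa using e0, by simpa using e1⟩

theorem exists_dual_generator {θ : L →+* L} {P Q : Matrix (Fin 2) (Fin 2) L} (hPQ : P * Q = 1)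
    {G : Matrix (Fin 2) (Fin 2) L} {H : L → Matrix (Fin 2) (Fin 2) L} (hG : IsDualRow F θ P 0 1 G)
    (hH : ∀ a : F₁, IsDualRow F θ P 1 a (H a)) {X : M2 F₁} (hX : IsRREF X) :
    ∃ X₁ : M2 F, toL X₁ = byShape (toL X) G H ∧
      ∀ (z : M2 F) (z' : M2 F₁), toL z' = P * ((toL z).map θ).transpose * Q →
        (z ∈ Ideal.span {X₁} ↔ X * z' = 0) := by
  have hQP : Q * P = 1 := mul_eq_one_comm.1 hPQ
  rcases isRREF_two_iff.1 hX with rfl | rfl | rfl | ⟨a, rfl⟩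
  · refine ⟨1, by simp [byShape], fun z z' _ => ?_⟩
    simp [Ideal.span_singleton_one]
  · refine ⟨0, by simp [byShape], fun z z' hz => ?_⟩
    rw [Ideal.mem_span_singleton', one_mul]
    simp only [mul_zero, exists_const]
    rw [← toL_injective.eq_iff (b := (0 : M2 F₁)), hz, toL_zero]
    constructor
    · rintro rfl
      simp
    · intro h
      have h2 : ((toL z).map θ).transpose = 0 := by
        rw [← one_mul ((toL z).map θ).transpose, ← hQP, ← mul_one ((toL z).map θ).transpose,
          ← hPQ]
        have := congrArg (fun M => Q * M * P) h
        simpa [← mul_assoc, hPQ, hQP, mul_assoc _ Q P] using this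
      symm
      apply toL_injective
      rw [toL_zero]
      apply Matrix.map_injective θ.injective
      change (toL z).map θ = (0 : Matrix (Fin 2) (Fin 2) L).map θ
      rw [Matrix.map_zero _ (map_zero θ), ← Matrix.transpose_injective.eq_iff, h2,
        Matrix.transpose_zero]
  · obtain ⟨y₀, y₁, c, hc, rfl, h0, h1⟩ := hG
    refine ⟨!![y₀, y₁; 0, 0], ?_, fun z z' hz => mem_span_iff_row_mul_eq_zero hPQ
      (x₀ := (0 : F₁)) (x₁ := 1) (Or.inr one_ne_zero) hc (by simpa using h0) (by simpa using h1) hz⟩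
    have n0 : toL !![(0 : F₁), 1; 0, 0] ≠ 0 := fun h => by
      have := congrFun (congrFun h 0) 1
      simp at this
    have n1 : toL !![(0 : F₁), 1; 0, 0] ≠ 1 := fun h => by
      have := congrFun (congrFun h 0) 1
      simp at this
    rw [byShape, if_neg (by simp [n0, n1]), if_pos (by simp [toL_of]), toL_of]
    rfl
  · obtain ⟨y₀, y₁, c, hc, he, h0, h1⟩ := hH a
    refine ⟨!![y₀, y₁; 0, 0], ?_, fun z z' hz => mem_span_iff_row_mul_eq_zero hPQ
      (x₀ := (1 : F₁)) (x₁ := a) (Or.inl one_ne_zero) hc (by simpa using h0) (by simpa using h1) hz⟩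
    have n0 : toL !![(1 : F₁), a; 0, 0] ≠ 0 := fun h => by
      have := congrFun (congrFun h 0) 0
      simp at this
    have n1 : toL !![(1 : F₁), a; 0, 0] ≠ 1 := fun h => by
      have := congrFun (congrFun h 1) 1
      simp at this
    have n2 : toL !![(1 : F₁), a; 0, 0] ≠ !![0, 1; 0, 0] := fun h => by
      have := congrFun (congrFun h 0) 0
      simp at this
    rw [byShape, if_neg (by simp [n0, n1]), if_neg n2, toL_of, toL_of]
    exact he.symm

end DualGenerator

end DihedralCodes

namespace DihedralCodes

/-! ### Dual ideals in one or two matrix summands -/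

section DualIdeals

variable {K L : Type u} [Field K] [Field L] [Algebra K L] {F₁ F : IntermediateField K L}

theorem forall_mem_span_mul_eq_zero_iff {R : Type*} [Ring R] {x y : R} :
    (∀ w ∈ Ideal.span {x}, w * y = 0) ↔ x * y = 0 := by
  constructor
  · intro h
    exact h x (Ideal.mem_span_singleton_self x)
  · intro h w hw
    obtain ⟨a, rfl⟩ := Ideal.mem_span_singleton'.1 hw
    rw [mul_assoc, h, mul_zero]

theorem forall_mem_prod_mul_eq_zero_iff {R S : Type*} [Ring R] [Ring S] {I : Ideal R} {J : Ideal S}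
    {y : R × S} : (∀ w ∈ Ideal.prod I J, w * y = 0) ↔
      (∀ a ∈ I, a * y.1 = 0) ∧ ∀ b ∈ J, b * y.2 = 0 := by
  constructor
  · intro h
    refine ⟨fun a ha => ?_, fun b hb => ?_⟩
    · have := h (a, 0) ((Ideal.mem_prod _ _).2 ⟨ha, J.zero_mem⟩)
      exact congrArg Prod.fst this
    · have := h (0, b) ((Ideal.mem_prod _ _).2 ⟨I.zero_mem, hb⟩)
      exact congrArg Prod.snd this
  · rintro ⟨h1, h2⟩ w hw
    obtain ⟨hw1, hw2⟩ := (Ideal.mem_prod _ _).1 hw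
    exact Prod.ext (h1 _ hw1) (h2 _ hw2)

/-- As `ρ` is surjective, the annihilator condition determines `I'`, so every reduced generator of
`I` yields the same dual ideal. -/
theorem exists_dual_single {A : Type*} {ρ : A → M2 F} (hρ : Function.Surjective ρ) {h : A → A}
    {θ : L →+* L} {P Q : Matrix (Fin 2) (Fin 2) L} (hPQ : P * Q = 1)
    (hρh : ∀ u, toL (ρ (h u)) = P * ((toL (ρ u)).map θ).transpose * Q)
    {G : Matrix (Fin 2) (Fin 2) L} {H : L → Matrix (Fin 2) (Fin 2) L} (hG : IsDualRow F θ P 0 1 G)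
    (hH : ∀ a : F, IsDualRow F θ P 1 a (H a)) (I : Ideal (M2 F)) :
    ∃ I' : Ideal (M2 F), (∀ u, ρ u ∈ I' ↔ ∀ w ∈ I, w * ρ (h u) = 0) ∧
      (∃ X, IsRREF X ∧ I = Ideal.span {X}) ∧
      ∀ X, IsRREF X → I = Ideal.span {X} →
        ∃ X₁, I' = Ideal.span {X₁} ∧ toL X₁ = byShape (toL X) G H := by
  have key : ∀ X, IsRREF X → I = Ideal.span {X} → ∃ X₁ : M2 F, toL X₁ = byShape (toL X) G H ∧
      ∀ u, ρ u ∈ Ideal.span {X₁} ↔ ∀ w ∈ I, w * ρ (h u) = 0 := by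
    rintro X hX rfl
    obtain ⟨X₁, hs, hX₁⟩ := exists_dual_generator hPQ hG hH hX
    refine ⟨X₁, hs, fun u => ?_⟩
    rw [forall_mem_span_mul_eq_zero_iff]
    exact hX₁ _ _ (hρh u)
  obtain ⟨X, hX, hI⟩ := exists_isRREF_span_eq I
  obtain ⟨X₁, -, hI'⟩ := key X hX hI
  refine ⟨_, hI', ⟨X, hX, hI⟩, fun Y hY hIY => ?_⟩
  obtain ⟨Y₁, hs, hY₁⟩ := key Y hY hIY
  refine ⟨Y₁, ?_, hs⟩
  ext z
  obtain ⟨u, rfl⟩ := hρ z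
  rw [hI', hY₁]

/-- Each component of the adjoint depends on the other component of `ρ u`; hence the generator `X`
of the first summand of `I` controls the second summand of `I'`, and conversely. -/
theorem exists_dual_prod {A : Type*} {ρ : A → M2 F₁ × M2 F} (hρ : Function.Surjective ρ) {h : A → A}
    {θ₁ θ₂ : L →+* L} {P₁ Q₁ P₂ Q₂ : Matrix (Fin 2) (Fin 2) L} (hPQ₁ : P₁ * Q₁ = 1)
    (hPQ₂ : P₂ * Q₂ = 1)
    (hρ₁ : ∀ u, toL (ρ (h u)).1 = P₁ * ((toL (ρ u).2).map θ₁).transpose * Q₁)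
    (hρ₂ : ∀ u, toL (ρ (h u)).2 = P₂ * ((toL (ρ u).1).map θ₂).transpose * Q₂)
    {G₁ G₂ : Matrix (Fin 2) (Fin 2) L} {H₁ H₂ : L → Matrix (Fin 2) (Fin 2) L}
    (hG₁ : IsDualRow F θ₁ P₁ 0 1 G₁) (hH₁ : ∀ a : F₁, IsDualRow F θ₁ P₁ 1 a (H₁ a))
    (hG₂ : IsDualRow F₁ θ₂ P₂ 0 1 G₂) (hH₂ : ∀ a : F, IsDualRow F₁ θ₂ P₂ 1 a (H₂ a))
    (I : Ideal (M2 F₁ × M2 F)) :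
    ∃ I' : Ideal (M2 F₁ × M2 F), (∀ u, ρ u ∈ I' ↔ ∀ w ∈ I, w * ρ (h u) = 0) ∧
      (∃ X Y, IsRREF X ∧ IsRREF Y ∧ I = Ideal.prod (Ideal.span {X}) (Ideal.span {Y})) ∧
      ∀ X Y, IsRREF X → IsRREF Y → I = Ideal.prod (Ideal.span {X}) (Ideal.span {Y}) →
        ∃ Y₁ X₁, I' = Ideal.prod (Ideal.span {Y₁}) (Ideal.span {X₁}) ∧
          toL X₁ = byShape (toL X) G₁ H₁ ∧ toL Y₁ = byShape (toL Y) G₂ H₂ := by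
  have key : ∀ X Y, IsRREF X → IsRREF Y → I = Ideal.prod (Ideal.span {X}) (Ideal.span {Y}) →
      ∃ (Y₁ : M2 F₁) (X₁ : M2 F), (toL X₁ = byShape (toL X) G₁ H₁ ∧
        toL Y₁ = byShape (toL Y) G₂ H₂) ∧
        ∀ u, ρ u ∈ Ideal.prod (Ideal.span {Y₁}) (Ideal.span {X₁}) ↔
          ∀ w ∈ I, w * ρ (h u) = 0 := by
    rintro X Y hX hY rfl
    obtain ⟨X₁, hs, hX₁⟩ := exists_dual_generator hPQ₁ hG₁ hH₁ hX
    obtain ⟨Y₁, ht, hY₁⟩ := exists_dual_generator hPQ₂ hG₂ hH₂ hY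
    refine ⟨Y₁, X₁, ⟨hs, ht⟩, fun u => ?_⟩
    rw [forall_mem_prod_mul_eq_zero_iff, forall_mem_span_mul_eq_zero_iff,
      forall_mem_span_mul_eq_zero_iff, Ideal.mem_prod, hX₁ _ _ (hρ₁ u), hY₁ _ _ (hρ₂ u), and_comm]
  obtain ⟨X, hX, hIX⟩ := exists_isRREF_span_eq (I.map (RingHom.fst _ _))
  obtain ⟨Y, hY, hIY⟩ := exists_isRREF_span_eq (I.map (RingHom.snd _ _))
  have hI : I = Ideal.prod (Ideal.span {X}) (Ideal.span {Y}) := by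
    rw [← hIX, ← hIY]
    exact Ideal.ideal_prod_eq I
  obtain ⟨Y₁, X₁, -, hI'⟩ := key X Y hX hY hI
  refine ⟨_, hI', ⟨X, Y, hX, hY, hI⟩, fun X' Y' hX' hY' hI₂ => ?_⟩
  obtain ⟨Y₂, X₂, hs, h₂⟩ := key X' Y' hX' hY' hI₂
  refine ⟨Y₂, X₂, ?_, hs⟩
  ext z
  obtain ⟨u, rfl⟩ := hρ z
  rw [hI', h₂]

end DualIdeals

/-! ### Group algebra elements as pairs of polynomials -/

section Coordinates

open DihedralGroup

variable {K : Type*} [Field K] {n : ℕ} [NeZero n]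

/-- The polynomial `∑ i, u_{a ^ i} x ^ i`. -/
noncomputable def rotPoly (u : MonoidAlgebra K (DihedralGroup n)) : K[X] :=
  ∑ i : ZMod n, monomial i.val (u.coeff (r i))

/-- The polynomial `∑ i, u_{b a ^ i} x ^ i`. -/
noncomputable def reflPoly (u : MonoidAlgebra K (DihedralGroup n)) : K[X] :=
  ∑ i : ZMod n, monomial i.val (u.coeff (sr i))

theorem coeff_sum_monomial_val (c : ZMod n → K) (i : ZMod n) :
    (∑ j : ZMod n, monomial j.val (c j)).coeff i.val = c i := by
  simp [coeff_monomial, (ZMod.val_injective n).eq_iff]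

theorem eq_zero_of_dvd_sum_monomial_val {c : ZMod n → K}
    (h : (X ^ n - 1 : K[X]) ∣ ∑ j : ZMod n, monomial j.val (c j)) (i : ZMod n) : c i = 0 := by
  rw [← coeff_sum_monomial_val c i, eq_zero_of_dvd_of_degree_lt h, coeff_zero]
  rw [← C_1, degree_X_pow_sub_C (NeZero.pos n)]
  refine mem_degreeLT.1 (Submodule.sum_mem _ fun j _ => mem_degreeLT.2 ?_)
  refine lt_of_le_of_lt (degree_monomial_le _ _) ?_
  exact_mod_cast ZMod.val_lt j

theorem eq_zero_of_dvd_polys {u : MonoidAlgebra K (DihedralGroup n)}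
    (h1 : (X ^ n - 1 : K[X]) ∣ rotPoly u) (h2 : (X ^ n - 1 : K[X]) ∣ reflPoly u) : u = 0 := by
  ext g
  cases g with
  | r i => exact eq_zero_of_dvd_sum_monomial_val h1 i
  | sr i => exact eq_zero_of_dvd_sum_monomial_val h2 i

/-- This is `u = R(a) + b S(a)`, which holds on group elements and extends linearly. -/
theorem algHom_eq_aeval {A : Type*} [Ring A] [Algebra K A]
    (Φ : MonoidAlgebra K (DihedralGroup n) →ₐ[K] A) (u : MonoidAlgebra K (DihedralGroup n)) :
    Φ u = aeval (Φ (MonoidAlgebra.of K _ (r 1))) (rotPoly u) +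
      Φ (MonoidAlgebra.of K _ (sr 0)) * aeval (Φ (MonoidAlgebra.of K _ (r 1))) (reflPoly u) := by
  induction u using MonoidAlgebra.induction_linear with
  | zero => simp [rotPoly, reflPoly]
  | add u v hu hv =>
    have e1 : rotPoly (u + v) = rotPoly u + rotPoly v := by
      simp [rotPoly, Finset.sum_add_distrib]
    have e2 : reflPoly (u + v) = reflPoly u + reflPoly v := by
      simp [reflPoly, Finset.sum_add_distrib]
    rw [e1, e2, map_add, map_add, map_add, mul_add, hu, hv]
    abel
  | single g c =>
    have hs : MonoidAlgebra.single g c = c • MonoidAlgebra.of K _ g := by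
      simp [MonoidAlgebra.of_apply]
    have hpow : ∀ i : ZMod n, Φ (MonoidAlgebra.of K _ (r 1)) ^ i.val =
        Φ (MonoidAlgebra.of K _ (r i)) := by
      intro i
      rw [← map_pow, ← map_pow, r_one_pow, ZMod.natCast_zmod_val]
    rw [rotPoly, reflPoly]
    cases g with
    | r i =>
      simp only [MonoidAlgebra.coeff_single, Finsupp.single_apply, reduceCtorEq, if_false, r.injEq,
        map_zero, Finset.sum_const_zero, mul_zero, add_zero]
      rw [Finset.sum_eq_single i (by intro j _ hj; rw [if_neg hj.symm, map_zero]) (by simp),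
        if_pos rfl, aeval_monomial, hpow, hs, map_smul, Algebra.smul_def]
    | sr i =>
      simp only [MonoidAlgebra.coeff_single, Finsupp.single_apply, reduceCtorEq, if_false,
        sr.injEq, map_zero, Finset.sum_const_zero, zero_add]
      rw [Finset.sum_eq_single i (by intro j _ hj; rw [if_neg hj.symm, map_zero]) (by simp),
        if_pos rfl, aeval_monomial, hpow, hs, map_smul, ← mul_assoc, ← Algebra.commutes, mul_assoc,
        ← map_mul, ← map_mul, sr_mul_r, zero_add, Algebra.smul_def]

theorem aeval_diagonal_conj {L : Type*} [Field L] [Algebra K L] {Z Z' : Matrix (Fin 2) (Fin 2) L}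
    (hZ : Z * Z' = 1) (β γ : L) (p : K[X]) :
    aeval (Z' * !![β, 0; 0, γ] * Z) p = Z' * !![aeval β p, 0; 0, aeval γ p] * Z := by
  have hZ' : Z' * Z = 1 := mul_eq_one_comm.1 hZ
  induction p using Polynomial.induction_on' with
  | add p q hp hq =>
    rw [map_add, hp, hq, map_add, map_add, ← add_mul, ← mul_add]
    simp
  | monomial k c =>
    have hk : (Z' * !![β, 0; 0, γ] * Z) ^ k = Z' * !![β ^ k, 0; 0, γ ^ k] * Z := by
      induction k with
      | zero =>
        rw [pow_zero, pow_zero, pow_zero, ← Matrix.one_fin_two, mul_one, hZ']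
      | succ k ih =>
        rw [pow_succ, ih]
        calc Z' * !![β ^ k, 0; 0, γ ^ k] * Z * (Z' * !![β, 0; 0, γ] * Z)
            = Z' * !![β ^ k, 0; 0, γ ^ k] * (Z * Z') * !![β, 0; 0, γ] * Z := by
              simp only [mul_assoc]
          _ = Z' * (!![β ^ k, 0; 0, γ ^ k] * !![β, 0; 0, γ]) * Z := by
              rw [hZ, mul_one]; simp only [mul_assoc]
          _ = _ := by simp [pow_succ]
    rw [aeval_monomial, hk, ← Algebra.smul_def, aeval_monomial, aeval_monomial,
      ← Algebra.smul_def, ← Algebra.smul_def, ← smul_mul_assoc, ← mul_smul_comm]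
    simp [Matrix.smul_of]

/-- After undoing the conjugation by `Z`, the matrix of `u` has rows `(R(β), S(γ))` and `(S(β),
R(γ))`. -/
theorem aeval_polys_eq_zero {L : Type*} [Field L] [Algebra K L] {Z Z' : Matrix (Fin 2) (Fin 2) L}
    (hZ : Z * Z' = 1) {β γ : L} {Φ : MonoidAlgebra K (DihedralGroup n) →ₐ[K] Matrix (Fin 2) (Fin 2) L}
    (ha : Φ (MonoidAlgebra.of K _ (r 1)) = Z' * !![β, 0; 0, γ] * Z)
    (hb : Φ (MonoidAlgebra.of K _ (sr 0)) = Z' * !![0, 1; 1, 0] * Z)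
    {u : MonoidAlgebra K (DihedralGroup n)} (hu : Φ u = 0) :
    (aeval β (rotPoly u) = 0 ∧ aeval γ (rotPoly u) = 0) ∧
      aeval β (reflPoly u) = 0 ∧ aeval γ (reflPoly u) = 0 := by
  rw [algHom_eq_aeval, ha, hb, aeval_diagonal_conj hZ, aeval_diagonal_conj hZ] at hu
  have h2 := congrArg (fun M => Z * M * Z') hu
  have h3 : Z * (Z' * !![aeval β (rotPoly u), 0; 0, aeval γ (rotPoly u)] * Z +
      Z' * !![0, 1; 1, 0] * Z * (Z' * !![aeval β (reflPoly u), 0; 0, aeval γ (reflPoly u)] * Z)) *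
        Z' = !![aeval β (rotPoly u), 0; 0, aeval γ (rotPoly u)] +
          !![0, 1; 1, 0] * !![aeval β (reflPoly u), 0; 0, aeval γ (reflPoly u)] := by
    have e : ∀ M N R : Matrix (Fin 2) (Fin 2) L,
        Z * (Z' * M * Z + Z' * N * Z * (Z' * R * Z)) * Z' =
          (Z * Z') * M * (Z * Z') + (Z * Z') * N * (Z * Z') * R * (Z * Z') := by
      intro M N R
      simp only [mul_add, add_mul, mul_assoc]
    rw [e, hZ]
    simp only [mul_one, one_mul]
  simp only [h3, mul_zero, zero_mul] at h2
  have e00 := congrFun (congrFun h2 0) 0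
  have e01 := congrFun (congrFun h2 0) 1
  have e10 := congrFun (congrFun h2 1) 0
  have e11 := congrFun (congrFun h2 1) 1
  simp at e00 e01 e10 e11
  exact ⟨⟨e00, e11⟩, e10, e01⟩

end Coordinates

end DihedralCodes

namespace DihedralCodes

/-! ### Minimal polynomials of `α ^ q` and `α⁻¹` -/

section MinimalPolynomials

variable {K L : Type u} [Field K] [Finite K] [Field L] [Algebra K L] {q : ℕ}

omit [Finite K] in
theorem recip_minpoly {α : L} (hi : IsIntegral K α) (h0 : α ≠ 0) :
    recip (minpoly K α) = minpoly K α⁻¹ :=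
  eq_minpoly_of_adjoin_eq hi (adjoin_inv_eq_adjoin α)
    (monic_recip (minpoly.coeff_zero_ne_zero hi h0))
    (natDegree_recip (minpoly.coeff_zero_ne_zero hi h0)) (aeval_recip h0 (minpoly.aeval K α))

theorem conjPoly_minpoly (hq : Nat.card K = q ^ 2) {α : L} (hi : IsIntegral K α) :
    conjPoly q (minpoly K α) = minpoly K (α ^ q) :=
  eq_minpoly_of_adjoin_eq hi (adjoin_pow_eq_adjoin hq hi)
    (monic_conjPoly hq (minpoly.monic hi)) (natDegree_conjPoly hq _)
    (aeval_conjPoly hq (minpoly.aeval K α))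

omit [Finite K] in
theorem natDegree_minpoly_eq_of_adjoin_eq {α β : L} (hα : IsIntegral K α) (hβ : IsIntegral K β)
    (h : K⟮β⟯ = K⟮α⟯) : (minpoly K β).natDegree = (minpoly K α).natDegree := by
  rw [← IntermediateField.adjoin.finrank hα, ← h, IntermediateField.adjoin.finrank hβ]

theorem natDegree_minpoly_pow (hq : Nat.card K = q ^ 2) {α : L} (hi : IsIntegral K α) :
    (minpoly K (α ^ q)).natDegree = (minpoly K α).natDegree :=
  natDegree_minpoly_eq_of_adjoin_eq hi (hi.pow q) (adjoin_pow_eq_adjoin hq hi)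

omit [Finite K] in
theorem natDegree_minpoly_inv {α : L} (hi : IsIntegral K α) :
    (minpoly K α⁻¹).natDegree = (minpoly K α).natDegree :=
  natDegree_minpoly_eq_of_adjoin_eq hi hi.inv (adjoin_inv_eq_adjoin α)

omit [Finite K] in
theorem exists_algebraMap_eq_of_eq_inv {α : L} (h0 : α ≠ 0) (h : α = α⁻¹) :
    ∃ ε : K, (ε = 1 ∨ ε = -1) ∧ algebraMap K L ε = α := by
  have h1 : α * α = 1 := by
    nth_rewrite 2 [h]
    exact mul_inv_cancel₀ h0
  rcases mul_self_eq_one_iff.1 h1 with h | h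
  · exact ⟨1, Or.inl rfl, by simp [h]⟩
  · exact ⟨-1, Or.inr rfl, by simp [h]⟩

theorem minpoly_pow_eq_of_eq_inv (hq : Nat.card K = q ^ 2) {α : L} (h0 : α ≠ 0) (h : α = α⁻¹) :
    minpoly K (α ^ q) = minpoly K α := by
  obtain ⟨θ, hθ⟩ := exists_ringHom_pow hq L 1
  obtain ⟨ε, hε, rfl⟩ := exists_algebraMap_eq_of_eq_inv (K := K) h0 h
  have h2 := hθ (algebraMap K L ε)
  rw [pow_one] at h2
  rw [← h2]
  rcases hε with rfl | rfl <;> simp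

/-- Self-conjugacy forces odd degree, whereas self-reciprocity with `α ≠ α⁻¹` forces even degree. So
class J0 contains only `x ± 1`. -/
theorem eq_inv_of_minpoly_eq (hq : Nat.card K = q ^ 2) {α : L} (hi : IsIntegral K α)
    (h1 : minpoly K α = minpoly K (α ^ q)) (h2 : minpoly K α = minpoly K α⁻¹) : α = α⁻¹ := by
  by_contra hne
  have ho := (pow_natDegree_eq_of_pow_conj hq hi (Or.inl rfl)
    (by rw [h1]; exact minpoly.aeval K _)).1
  have he := (pow_natDegree_eq_inv_of_inv_conj hq hi hne (by rw [h2]; exact minpoly.aeval K _)).1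
  exact (Nat.not_even_iff_odd.2 ho) he

theorem add_pow_pow (hq : Nat.card K = q ^ 2) (x y : L) (m : ℕ) :
    (x + y) ^ q ^ m = x ^ q ^ m + y ^ q ^ m := by
  obtain ⟨θ, hθ⟩ := exists_ringHom_pow hq L m
  rw [← hθ, map_add, hθ, hθ]

theorem ne_zero_of_card (hq : Nat.card K = q ^ 2) : q ≠ 0 := by
  rintro rfl
  exact Nat.card_pos.ne' hq

end MinimalPolynomials

/-! ### Two-dimensional representations over subfields of `L` -/

section Representations

open DihedralGroup

variable {K L : Type u} [Field K] [Field L] [Algebra K L] {n : ℕ} [NeZero n]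

/-- The inclusion of matrix algebras. -/
noncomputable def toLHom (F : IntermediateField K L) : M2 F →ₐ[K] Matrix (Fin 2) (Fin 2) L :=
  F.val.mapMatrix

theorem toLHom_apply {F : IntermediateField K L} (z : M2 F) : toLHom F z = toL z := rfl

/-- The dihedral relations are checked over `L`, where the images are conjugate to standard ones,
and descend by injectivity; `β` itself need not lie in `F`. -/
theorem exists_algHom_of_toL_eq {F : IntermediateField K L} {Z Z' : Matrix (Fin 2) (Fin 2) L}
    (hZ : Z * Z' = 1) {β : L} (hβ : β ^ n = 1) (A B : M2 F)
    (hA : toL A = Z' * !![β, 0; 0, β⁻¹] * Z) (hB : toL B = Z' * !![0, 1; 1, 0] * Z) :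
    ∃ ρ : MonoidAlgebra K (DihedralGroup n) →ₐ[K] M2 F,
      ρ (MonoidAlgebra.of K _ (r 1)) = A ∧ ρ (MonoidAlgebra.of K _ (sr 0)) = B := by
  have hZ' : Z' * Z = 1 := mul_eq_one_comm.1 hZ
  have h0 : β ≠ 0 := by
    rintro rfl
    rw [zero_pow (NeZero.ne n)] at hβ
    exact zero_ne_one hβ
  have hmul : ∀ M N : Matrix (Fin 2) (Fin 2) L, Z' * M * Z * (Z' * N * Z) = Z' * (M * N) * Z := by
    intro M N
    calc Z' * M * Z * (Z' * N * Z) = Z' * M * (Z * Z') * N * Z := by simp only [mul_assoc]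
      _ = _ := by rw [hZ, mul_one]; simp only [mul_assoc]
  apply exists_algHom_dihedral
  · apply toL_injective
    rw [← toLHom_apply, map_pow, toLHom_apply, hA]
    have := aeval_diagonal_conj hZ β β⁻¹ (X ^ n : K[X])
    rw [map_pow, aeval_X] at this
    rw [this, map_pow, map_pow, aeval_X, aeval_X, inv_pow, hβ, inv_one, ← Matrix.one_fin_two,
      mul_one, hZ', toL_one]
  · apply toL_injective
    rw [toL_mul, hB, hmul, toL_one, ← hZ']
    simp [← Matrix.one_fin_two]
  · apply toL_injective
    rw [toL_mul, toL_mul, hB, hA, hmul, hmul]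
    simp [h0]

theorem exists_diagonal_algHom {F : IntermediateField K L} {β : L} (hF : β ∈ F) (hβ : β ^ n = 1) :
    ∃ ρ : MonoidAlgebra K (DihedralGroup n) →ₐ[K] M2 F,
      toL (ρ (MonoidAlgebra.of K _ (r 1))) = !![β, 0; 0, β⁻¹] ∧
      toL (ρ (MonoidAlgebra.of K _ (sr 0))) = !![0, 1; 1, 0] := by
  obtain ⟨ρ, h1, h2⟩ := exists_algHom_of_toL_eq (K := K) (n := n) (one_mul 1) hβ
    (!![⟨β, hF⟩, 0; 0, ⟨β⁻¹, inv_mem hF⟩] : M2 F) !![0, 1; 1, 0]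
    (by rw [toL_of, one_mul, mul_one]; rfl) (by rw [toL_of, one_mul, mul_one]; rfl)
  exact ⟨ρ, by rw [h1, toL_of]; rfl, by rw [h2, toL_of]; rfl⟩

theorem zMat_mul_inv {α : L} (h : α ≠ α⁻¹) : zMat α * (zMat α)⁻¹ = 1 := by
  apply Matrix.mul_nonsing_inv
  rw [zMat, Matrix.det_fin_two_of, isUnit_iff_ne_zero]
  intro h'
  apply h
  linear_combination h'

theorem sigma_eq_of_mul_eq {α : L} (h : α ≠ α⁻¹) {M N : Matrix (Fin 2) (Fin 2) L}
    (hMN : M * zMat α = zMat α * N) : sigma α M = N := by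
  rw [sigma, mul_assoc, hMN, ← mul_assoc, mul_eq_one_comm.1 (zMat_mul_inv h), one_mul]

/-- The entries involve only `α + α⁻¹`: conjugating by `Z` is what makes the representation descend
to `K(α + α⁻¹)`. -/
theorem sigma_diagonal {α : L} (h0 : α ≠ 0) (h : α ≠ α⁻¹) :
    sigma α !![α, 0; 0, α⁻¹] = !![0, 1; -1, α + α⁻¹] := by
  apply sigma_eq_of_mul_eq h
  rw [zMat, Matrix.mul_fin_two, Matrix.mul_fin_two]
  ext i k
  fin_cases i <;> fin_cases k <;> simp <;> field_simp <;> ring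

theorem sigma_swap {α : L} (h : α ≠ α⁻¹) :
    sigma α !![0, 1; 1, 0] = !![1, -(α + α⁻¹); 0, -1] := by
  apply sigma_eq_of_mul_eq h
  rw [zMat, Matrix.mul_fin_two, Matrix.mul_fin_two]
  ext i k
  fin_cases i <;> fin_cases k <;> simp

theorem exists_sigma_algHom {F : IntermediateField K L} {β : L} (hF : β + β⁻¹ ∈ F)
    (hne : β ≠ β⁻¹) (hβ : β ^ n = 1) :
    ∃ ρ : MonoidAlgebra K (DihedralGroup n) →ₐ[K] M2 F,
      toL (ρ (MonoidAlgebra.of K _ (r 1))) = sigma β !![β, 0; 0, β⁻¹] ∧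
      toL (ρ (MonoidAlgebra.of K _ (sr 0))) = sigma β !![0, 1; 1, 0] := by
  have h0 : β ≠ 0 := by
    rintro rfl
    rw [zero_pow (NeZero.ne n)] at hβ
    exact zero_ne_one hβ
  have hA : toL (!![0, 1; -1, ⟨β + β⁻¹, hF⟩] : M2 F) = sigma β !![β, 0; 0, β⁻¹] := by
    rw [toL_of, sigma_diagonal h0 hne]
    simp
  have hB : toL (!![1, -⟨β + β⁻¹, hF⟩; 0, -1] : M2 F) = sigma β !![0, 1; 1, 0] := by
    rw [toL_of, sigma_swap hne]
    simp
  obtain ⟨ρ, h1, h2⟩ := exists_algHom_of_toL_eq (K := K) (n := n) (zMat_mul_inv hne) hβ _ _ hA hB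
  exact ⟨ρ, by rw [h1, hA], by rw [h2, hB]⟩

theorem finrank_M2_adjoin {β : L} (hi : IsIntegral K β) :
    Module.Finite K (M2 K⟮β⟯) ∧ Module.finrank K (M2 K⟮β⟯) = 4 * (minpoly K β).natDegree := by
  have := IntermediateField.adjoin.finiteDimensional hi
  refine ⟨inferInstance, ?_⟩
  rw [Module.finrank_matrix, IntermediateField.adjoin.finrank hi]
  simp

theorem finrank_M2_prod {β γ : L} (hβ : IsIntegral K β) (hγ : IsIntegral K γ) :
    Module.Finite K (M2 K⟮β⟯ × M2 K⟮γ⟯) ∧ Module.finrank K (M2 K⟮β⟯ × M2 K⟮γ⟯) =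
      4 * (minpoly K β).natDegree + 4 * (minpoly K γ).natDegree := by
  obtain ⟨f1, h1⟩ := finrank_M2_adjoin hβ
  obtain ⟨f2, h2⟩ := finrank_M2_adjoin hγ
  refine ⟨inferInstance, ?_⟩
  rw [Module.finrank_prod, h1, h2]

theorem minpoly_dvd_polys {F : IntermediateField K L} {Z Z' : Matrix (Fin 2) (Fin 2) L}
    (hZ : Z * Z' = 1) {β : L} {ρ : MonoidAlgebra K (DihedralGroup n) →ₐ[K] M2 F}
    (ha : toL (ρ (MonoidAlgebra.of K _ (r 1))) = Z' * !![β, 0; 0, β⁻¹] * Z)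
    (hb : toL (ρ (MonoidAlgebra.of K _ (sr 0))) = Z' * !![0, 1; 1, 0] * Z)
    {u : MonoidAlgebra K (DihedralGroup n)} (hu : ρ u = 0) :
    (minpoly K β ∣ rotPoly u ∧ minpoly K β⁻¹ ∣ rotPoly u) ∧
      minpoly K β ∣ reflPoly u ∧ minpoly K β⁻¹ ∣ reflPoly u := by
  have h := aeval_polys_eq_zero (Φ := (toLHom F).comp ρ) hZ ha hb (u := u)
    (by rw [AlgHom.comp_apply, hu, map_zero])
  exact ⟨⟨minpoly.dvd K _ h.1.1, minpoly.dvd K _ h.1.2⟩,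
    minpoly.dvd K _ h.2.1, minpoly.dvd K _ h.2.2⟩

theorem toL_hermAdjoint {F₁ F₂ : IntermediateField K L} [Finite K] {q : ℕ}
    (hq : Nat.card K = q ^ 2)
    (ρ₁ : MonoidAlgebra K (DihedralGroup n) →ₐ[K] M2 F₁)
    (ρ₂ : MonoidAlgebra K (DihedralGroup n) →ₐ[K] M2 F₂) {m : ℕ} (hm : Odd m)
    {θ : L →+* L} (hθ : ∀ x, θ x = x ^ q ^ m) {P Q : Matrix (Fin 2) (Fin 2) L} (hPQ : P * Q = 1)
    (ha : toL (ρ₂ (MonoidAlgebra.of K _ (r 1))) *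
      (P * ((toL (ρ₁ (MonoidAlgebra.of K _ (r 1)))).map θ).transpose * Q) = 1)
    (hb : toL (ρ₂ (MonoidAlgebra.of K _ (sr 0))) *
      (P * ((toL (ρ₁ (MonoidAlgebra.of K _ (sr 0)))).map θ).transpose * Q) = 1)
    (u : MonoidAlgebra K (DihedralGroup n)) :
    toL (ρ₂ (hermAdjoint q u)) = P * ((toL (ρ₁ u)).map θ).transpose * Q :=
  algHom_hermAdjoint_matrix (ne_zero_of_card hq)
    (fun x y => by simpa using add_pow_pow (L := K) hq x y 1) ((toLHom F₁).comp ρ₁)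
    ((toLHom F₂).comp ρ₂) θ (fun c => by rw [hθ, algebraMap_pow_of_odd hq hm]) P Q hPQ ha hb u

end Representations

end DihedralCodes

/-! ### The components of classes J2, J3 and J4 -/

namespace DihedralCodes

open DihedralGroup

variable {K L : Type u} [Field K] [Finite K] [Field L] [Algebra K L] {q n : ℕ} [NeZero n]

/-- The component of a factor `f` of class `c` with root `α` carries a representation of the
dihedral group with the prescribed generator images, whose kernel and hermitian duality are as
expected. -/
def HasComponent (q n : ℕ) [NeZero n] (f : K[X]) (α : L) (c : FactorClass) : Prop :=
  Module.Finite K (Comp K q α c) ∧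
    Module.finrank K (Comp K q α c) ≤ 2 * (blockPoly q f c).natDegree ∧
    ∃ ρ : MonoidAlgebra K (DihedralGroup n) →ₐ[K] Comp K q α c,
      IsGeneratorImage q f α c (ρ (MonoidAlgebra.of K _ (r 1))) (ρ (MonoidAlgebra.of K _ (sr 0))) ∧
      (∀ u, ρ u = 0 → blockPoly q f c ∣ rotPoly u ∧ blockPoly q f c ∣ reflPoly u) ∧
      (Function.Surjective ρ → ∀ I : Ideal (Comp K q α c), ∃ I' : Ideal (Comp K q α c),
        (∀ u, ρ u ∈ I' ↔ ∀ w ∈ I, w * ρ (hermAdjoint q u) = 0) ∧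
        IsDualComponent q f.natDegree α c I I')

omit [Finite K] in
theorem mul_dvd_of_separable {f g p : K[X]} (h : (f * g).Separable) (hf : f ∣ p) (hg : g ∣ p) :
    f * g ∣ p :=
  h.isCoprime.mul_dvd hf hg

theorem swap_mul_swap (R : Type*) [CommRing R] :
    (!![0, 1; 1, 0] : Matrix (Fin 2) (Fin 2) R) * !![0, 1; 1, 0] = 1 := by
  rw [Matrix.mul_fin_two, Matrix.one_fin_two]
  simp

omit [Finite K] in
-- Conjugation by the swap inverts the diagonal matrix, so the adjoint of the rotation is its
-- inverse as soon as `θ` matches the eigenvalues.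
theorem diagonal_mul_swap_adjoint {β γ : L} {θ : L →+* L} (hβ : β ≠ 0) (h : θ γ = β) :
    !![β, 0; 0, β⁻¹] * (!![0, 1; 1, 0] *
      ((!![γ, 0; 0, γ⁻¹] : Matrix (Fin 2) (Fin 2) L).map θ).transpose * !![0, 1; 1, 0]) = 1 := by
  have e : ((!![γ, 0; 0, γ⁻¹] : Matrix (Fin 2) (Fin 2) L).map θ).transpose =
      !![β, 0; 0, β⁻¹] := by
    ext i k
    fin_cases i <;> fin_cases k <;> simp [h]
  rw [e, Matrix.mul_fin_two, Matrix.mul_fin_two, Matrix.mul_fin_two, Matrix.one_fin_two]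
  simp [hβ]

theorem swap_mul_swap_adjoint (θ : L →+* L) :
    (!![0, 1; 1, 0] : Matrix (Fin 2) (Fin 2) L) * (!![0, 1; 1, 0] *
      ((!![0, 1; 1, 0] : Matrix (Fin 2) (Fin 2) L).map θ).transpose * !![0, 1; 1, 0]) = 1 := by
  have e : ((!![0, 1; 1, 0] : Matrix (Fin 2) (Fin 2) L).map θ).transpose =
      !![0, 1; 1, 0] := by
    ext i k
    fin_cases i <;> fin_cases k <;> simp
  rw [e, swap_mul_swap, one_mul, swap_mul_swap]

omit [Finite K] in
theorem isDualRow_swap_second (F : IntermediateField K L) (θ : L →+* L) :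
    IsDualRow F θ !![0, 1; 1, 0] 0 1 !![0, 1; 0, 0] :=
  ⟨0, 1, 1, one_ne_zero, by simp, by simp, by simp⟩

omit [Finite K] in
theorem isDualRow_swap_first {F : IntermediateField K L} {θ : L →+* L} {a b : L} (hb : b ∈ F)
    (h : θ b = a) : IsDualRow F θ !![0, 1; 1, 0] 1 a !![1, -b; 0, 0] :=
  ⟨1, -⟨b, hb⟩, -1, by simp, by simp, by simp [h], by simp⟩

section Paired

variable {α : L}

omit [Finite K] in
theorem block_dvd_of_minpoly_dvd {p : K[X]} (hα : IsIntegral K α) (h0 : α ≠ 0)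
    (hsep : (minpoly K α * recip (minpoly K α)).Separable)
    (h : minpoly K α ∣ p ∧ minpoly K α⁻¹ ∣ p) : minpoly K α * recip (minpoly K α) ∣ p :=
  mul_dvd_of_separable hsep h.1 (by rw [recip_minpoly hα h0]; exact h.2)

omit [Finite K] in
theorem natDegree_mul_recip_minpoly (hi : IsIntegral K α) (h0 : α ≠ 0) :
    (minpoly K α * recip (minpoly K α)).natDegree = 2 * (minpoly K α).natDegree := by
  rw [recip_minpoly hi h0, natDegree_mul (minpoly.ne_zero hi) (minpoly.ne_zero hi.inv),
    natDegree_minpoly_inv hi, two_mul]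

theorem pow_natDegree_mem_and_eq (hq : Nat.card K = q ^ 2) (hi : IsIntegral K α) {θ : L →+* L}
    (hθ : ∀ x, θ x = x ^ q ^ (minpoly K α).natDegree) (a : K⟮α⟯) :
    (a : L) ^ q ^ (minpoly K α).natDegree ∈ K⟮α⟯ ∧
      θ ((a : L) ^ q ^ (minpoly K α).natDegree) = a := by
  refine ⟨pow_mem a.2 _, ?_⟩
  rw [hθ, ← pow_mul, ← pow_add, ← two_mul]
  exact pow_pow_eq_of_mem_adjoin hq ((natDegree_minpoly_dvd_iff hq hi).1 dvd_rfl) a.2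

/-- Here `r` is odd and `α ^ q ^ r = α`, so `θ` fixes the rotation and the swap has to invert it: `P
= Q` is the swap. -/
theorem hasComponent_J2 (hq : Nat.card K = q ^ 2) (hi : IsIntegral K α) (h0 : α ≠ 0)
    (hn : α ^ n = 1) (hsep : (blockPoly q (minpoly K α) .J2).Separable)
    (hc : minpoly K α = conjPoly q (minpoly K α)) :
    HasComponent q n (minpoly K α) α .J2 := by
  obtain ⟨hodd, hfix⟩ := pow_natDegree_eq_of_pow_conj hq hi (Or.inl rfl)
    (by rw [hc, conjPoly_minpoly hq hi]; exact minpoly.aeval K _)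
  obtain ⟨ρ, ha, hb⟩ := exists_diagonal_algHom (n := n)
    (IntermediateField.mem_adjoin_simple_self K α) hn
  obtain ⟨hfin, hrank⟩ := finrank_M2_adjoin hi
  obtain ⟨θ, hθ⟩ := exists_ringHom_pow hq L (minpoly K α).natDegree
  refine ⟨hfin, ?_, ρ, ⟨ha, hb⟩, ?_, fun hρ I => ?_⟩
  · change _ ≤ 2 * (minpoly K α * recip (minpoly K α)).natDegree
    rw [natDegree_mul_recip_minpoly hi h0]
    exact hrank.trans_le (by omega)
  · intro u hu
    obtain ⟨h1, h2⟩ := minpoly_dvd_polys (β := α) (one_mul 1) (by rw [ha]; simp) (by rw [hb]; simp) hu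
    exact ⟨block_dvd_of_minpoly_dvd hi h0 hsep h1, block_dvd_of_minpoly_dvd hi h0 hsep h2⟩
  · exact exists_dual_single hρ (swap_mul_swap L)
      (toL_hermAdjoint hq ρ ρ hodd hθ (swap_mul_swap L)
        (by rw [ha]; exact diagonal_mul_swap_adjoint h0 (by rw [hθ, hfix]))
        (by rw [hb]; exact swap_mul_swap_adjoint θ))
      (isDualRow_swap_second _ θ)
      (fun a => isDualRow_swap_first (pow_natDegree_mem_and_eq hq hi hθ a).1
        (pow_natDegree_mem_and_eq hq hi hθ a).2) I

/-- Here `r` is odd and `α ^ q ^ r = α⁻¹`, so `θ` already inverts the rotation and `P = Q = 1`. -/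
theorem hasComponent_J3 (hq : Nat.card K = q ^ 2) (hi : IsIntegral K α) (h0 : α ≠ 0)
    (hn : α ^ n = 1) (hsep : (blockPoly q (minpoly K α) .J3).Separable)
    (hc : conjPoly q (minpoly K α) = recip (minpoly K α)) :
    HasComponent q n (minpoly K α) α .J3 := by
  rw [conjPoly_minpoly hq hi, recip_minpoly hi h0] at hc
  have hroot : aeval (α⁻¹ ^ q) (minpoly K α) = 0 := by
    have h : minpoly K (α⁻¹ ^ q) = minpoly K α := by
      rw [inv_pow, ← recip_minpoly (hi.pow q) (pow_ne_zero q h0), hc,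
        recip_minpoly hi.inv (inv_ne_zero h0), inv_inv]
    rw [← h]
    exact minpoly.aeval K _
  obtain ⟨hodd, hfix⟩ := pow_natDegree_eq_of_pow_conj hq hi (Or.inr rfl) hroot
  obtain ⟨ρ, ha, hb⟩ := exists_diagonal_algHom (n := n)
    (IntermediateField.mem_adjoin_simple_self K α) hn
  obtain ⟨hfin, hrank⟩ := finrank_M2_adjoin hi
  obtain ⟨θ, hθ⟩ := exists_ringHom_pow hq L (minpoly K α).natDegree
  refine ⟨hfin, ?_, ρ, ⟨ha, hb⟩, ?_, fun hρ I => ?_⟩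
  · change _ ≤ 2 * (minpoly K α * recip (minpoly K α)).natDegree
    rw [natDegree_mul_recip_minpoly hi h0]
    exact hrank.trans_le (by omega)
  · intro u hu
    obtain ⟨h1, h2⟩ := minpoly_dvd_polys (β := α) (one_mul 1) (by rw [ha]; simp) (by rw [hb]; simp) hu
    exact ⟨block_dvd_of_minpoly_dvd hi h0 hsep h1, block_dvd_of_minpoly_dvd hi h0 hsep h2⟩
  · refine exists_dual_single hρ (one_mul 1)
      (toL_hermAdjoint hq ρ ρ hodd hθ (one_mul 1) ?_ ?_) ?_ (fun a => ?_) I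
    · have e : ((!![α, 0; 0, α⁻¹] : Matrix (Fin 2) (Fin 2) L).map θ).transpose =
          !![α⁻¹, 0; 0, α] := by
        ext i k
        fin_cases i <;> fin_cases k <;> simp [hθ, hfix, ne_zero_of_card hq]
      rw [ha, e, one_mul, mul_one, Matrix.mul_fin_two, Matrix.one_fin_two]
      simp [h0]
    · have e : ((!![0, 1; 1, 0] : Matrix (Fin 2) (Fin 2) L).map θ).transpose =
          !![0, 1; 1, 0] := by
        ext i k
        fin_cases i <;> fin_cases k <;> simp
      rw [hb, e, one_mul, mul_one, swap_mul_swap]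
    · exact ⟨1, 0, -1, by simp, by simp, by simp, by simp⟩
    · obtain ⟨hmem, ht⟩ := pow_natDegree_mem_and_eq hq hi hθ a
      exact ⟨-⟨_, hmem⟩, 1, 1, one_ne_zero, by simp, by simp, by simp [ht]⟩

end Paired

/-- The `q`-power takes the first summand to the second. The way back uses the exponent `2r - 1`,
which gives the inverse Frobenius on `K(α)` because `q ^ (2r)` fixes that field. -/
theorem hasComponent_J4 {α : L} (hq : Nat.card K = q ^ 2) (hi : IsIntegral K α) (h0 : α ≠ 0)
    (hn : α ^ n = 1) (hsep : (blockPoly q (minpoly K α) .J4).Separable) :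
    HasComponent q n (minpoly K α) α .J4 := by
  have hposdeg := minpoly.natDegree_pos hi
  have hfix : α ^ q ^ (2 * (minpoly K α).natDegree) = α :=
    (natDegree_minpoly_dvd_iff hq hi).1 dvd_rfl
  have hq0 : α ^ q ≠ 0 := pow_ne_zero q h0
  have hnq : (α ^ q) ^ n = 1 := by rw [pow_right_comm, hn, one_pow]
  obtain ⟨ρ₁, ha₁, hb₁⟩ := exists_diagonal_algHom (n := n)
    (IntermediateField.mem_adjoin_simple_self K α) hn
  obtain ⟨ρ₂, ha₂, hb₂⟩ := exists_diagonal_algHom (n := n)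
    (IntermediateField.mem_adjoin_simple_self K (α ^ q)) hnq
  obtain ⟨hfin, hrank⟩ := finrank_M2_prod hi (hi.pow q)
  obtain ⟨θ, hθ⟩ := exists_ringHom_pow hq L 1
  obtain ⟨τ, hτ⟩ := exists_ringHom_pow hq L (2 * (minpoly K α).natDegree - 1)
  have hrev : conjPoly q (recip (minpoly K α)) = minpoly K (α ^ q)⁻¹ := by
    rw [recip_minpoly hi h0, conjPoly_minpoly hq hi.inv, inv_pow]
  have hblock : blockPoly q (minpoly K α) .J4 =
      minpoly K α * minpoly K α⁻¹ * minpoly K (α ^ q) * minpoly K (α ^ q)⁻¹ := by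
    rw [← hrev, ← conjPoly_minpoly hq hi, ← recip_minpoly hi h0, blockPoly]
  rw [hblock] at hsep
  have hfixq : ∀ {x : L}, x ∈ K⟮α⟯ → (x ^ q ^ (2 * (minpoly K α).natDegree - 1)) ^ q = x := by
    intro x hx
    rw [← pow_mul, ← pow_succ, Nat.sub_add_cancel (by omega)]
    exact pow_pow_eq_of_mem_adjoin hq hfix hx
  have hτθ : ∀ {x : L}, x ∈ K⟮α⟯ → τ (x ^ q) = x := by
    intro x hx
    rw [hτ, pow_right_comm]
    exact hfixq hx
  have hαmem := IntermediateField.mem_adjoin_simple_self K α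
  have hadj : K⟮α ^ q⟯ = K⟮α⟯ := adjoin_pow_eq_adjoin hq hi
  have hdvd : ∀ {p : K[X]}, minpoly K α ∣ p → minpoly K α⁻¹ ∣ p → minpoly K (α ^ q) ∣ p →
      minpoly K (α ^ q)⁻¹ ∣ p → blockPoly q (minpoly K α) .J4 ∣ p := by
    intro p h1 h2 h3 h4
    rw [hblock]
    exact mul_dvd_of_separable hsep (mul_dvd_of_separable hsep.of_mul_left
      (mul_dvd_of_separable hsep.of_mul_left.of_mul_left h1 h2) h3) h4
  refine ⟨hfin, ?_, ρ₁.prod ρ₂, ⟨⟨ha₁, ha₂⟩, hb₁, hb₂⟩, ?_, fun hρ I => ?_⟩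
  · rw [hblock, natDegree_mul, natDegree_mul, natDegree_mul, natDegree_minpoly_inv hi,
      natDegree_minpoly_inv (hi.pow q), natDegree_minpoly_pow hq hi]
    · refine hrank.trans_le ?_
      rw [natDegree_minpoly_pow hq hi]
      omega
    all_goals simp [minpoly.ne_zero hi, minpoly.ne_zero hi.inv, minpoly.ne_zero (hi.pow q),
      minpoly.ne_zero (hi.pow q).inv]
  · intro u hu
    obtain ⟨h1, h2⟩ := minpoly_dvd_polys (β := α) (one_mul 1) (by rw [ha₁]; simp) (by rw [hb₁]; simp)
      (congrArg Prod.fst hu)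
    obtain ⟨h3, h4⟩ := minpoly_dvd_polys (β := α ^ q) (one_mul 1) (by rw [ha₂]; simp) (by rw [hb₂]; simp)
      (congrArg Prod.snd hu)
    exact ⟨hdvd h1.1 h1.2 h3.1 h3.2, hdvd h2.1 h2.2 h4.1 h4.2⟩
  · refine exists_dual_prod hρ (swap_mul_swap L) (swap_mul_swap L)
      (toL_hermAdjoint hq ρ₂ ρ₁ ⟨(minpoly K α).natDegree - 1, by omega⟩ hτ (swap_mul_swap L)
        (by rw [ha₁, ha₂]; exact diagonal_mul_swap_adjoint h0 (hτθ hαmem))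
        (by rw [hb₁, hb₂]; exact swap_mul_swap_adjoint τ))
      (toL_hermAdjoint hq ρ₁ ρ₂ odd_one hθ (swap_mul_swap L)
        (by rw [ha₁, ha₂]; exact diagonal_mul_swap_adjoint hq0 (by rw [hθ, pow_one]))
        (by rw [hb₁, hb₂]; exact swap_mul_swap_adjoint θ))
      (isDualRow_swap_second _ τ)
      (fun a => isDualRow_swap_first (by rw [hadj]; exact pow_mem a.2 _) (hτθ a.2))
      (isDualRow_swap_second _ θ)
      (fun a => ?_) I
    have ha : (a : L) ∈ K⟮α⟯ := by rw [← hadj]; exact a.2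
    exact isDualRow_swap_first (pow_mem ha _) (by rw [hθ, pow_one, hfixq ha])

/-! ### The components of class J1 -/

section SelfReciprocal

/-- The Gram matrix `W ᵀ S W` with `W` the matrix `zMat α`, where `t = α + α⁻¹`. -/
def gram (t : L) : Matrix (Fin 2) (Fin 2) L := !![2, -t; -t, 2]

/-- The inverse of `gram t`. -/
def gramInv (t : L) : Matrix (Fin 2) (Fin 2) L :=
  !![2 * (4 - t ^ 2)⁻¹, t * (4 - t ^ 2)⁻¹; t * (4 - t ^ 2)⁻¹, 2 * (4 - t ^ 2)⁻¹]

omit [Finite K] in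
theorem gramInv_mul_gram {t : L} (ht : 4 - t ^ 2 ≠ 0) : gramInv t * gram t = 1 := by
  rw [gramInv, gram, Matrix.mul_fin_two, Matrix.one_fin_two]
  have h : (4 - t ^ 2) * (4 - t ^ 2)⁻¹ = 1 := mul_inv_cancel₀ ht
  ext i k
  fin_cases i <;> fin_cases k <;> simp
  · linear_combination h
  · ring
  · ring
  · linear_combination h

omit [Finite K] in
-- The determinant of the Gram matrix is `-(β - β⁻¹) ^ 2`, also in characteristic two.
theorem four_sub_sq_ne_zero {β : L} (h0 : β ≠ 0) (h : β ≠ β⁻¹) : 4 - (β + β⁻¹) ^ 2 ≠ 0 := by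
  have e : 4 - (β + β⁻¹) ^ 2 = -(β - β⁻¹) ^ 2 := by
    field_simp
    ring
  rw [e, neg_ne_zero]
  exact pow_ne_zero 2 (sub_ne_zero.2 h)

omit [Finite K] in
theorem rotation_mul_gram_adjoint {t t' : L} {θ : L →+* L} (ht : 4 - t ^ 2 ≠ 0) (h : θ t' = t) :
    !![0, 1; -1, t] * (gramInv t *
      ((!![0, 1; -1, t'] : Matrix (Fin 2) (Fin 2) L).map θ).transpose * gram t) = 1 := by
  have e : ((!![0, 1; -1, t'] : Matrix (Fin 2) (Fin 2) L).map θ).transpose =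
      !![0, -1; 1, t] := by
    ext i k
    fin_cases i <;> fin_cases k <;> simp [h]
  have e2 : !![0, 1; -1, t] * gramInv t * !![0, -1; 1, t] = gramInv t := by
    have h : (4 - t ^ 2) * (4 - t ^ 2)⁻¹ = 1 := mul_inv_cancel₀ ht
    rw [gramInv, Matrix.mul_fin_two, Matrix.mul_fin_two]
    ext i k
    fin_cases i <;> fin_cases k <;> simp <;> ring
  rw [e, ← mul_assoc, ← mul_assoc, e2, gramInv_mul_gram ht]

omit [Finite K] in
theorem reflection_mul_gram_adjoint {t t' : L} {θ : L →+* L} (ht : 4 - t ^ 2 ≠ 0) (h : θ t' = t) :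
    !![1, -t; 0, -1] * (gramInv t *
      ((!![1, -t'; 0, -1] : Matrix (Fin 2) (Fin 2) L).map θ).transpose * gram t) = 1 := by
  have e : ((!![1, -t'; 0, -1] : Matrix (Fin 2) (Fin 2) L).map θ).transpose =
      !![1, 0; -t, -1] := by
    ext i k
    fin_cases i <;> fin_cases k <;> simp [h]
  have e2 : !![1, -t; 0, -1] * gramInv t * !![1, 0; -t, -1] = gramInv t := by
    rw [gramInv, Matrix.mul_fin_two, Matrix.mul_fin_two]
    ext i k
    fin_cases i <;> fin_cases k <;> simp <;> ring
  rw [e, ← mul_assoc, ← mul_assoc, e2, gramInv_mul_gram ht]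

omit [Finite K] in
theorem isDualRow_gramInv {F : IntermediateField K L} {θ : L →+* L} {t x₀ x₁ y₀ y₁ : L}
    (ht : 4 - t ^ 2 ≠ 0) (hy₀ : y₀ ∈ F) (hy₁ : y₁ ∈ F) (h₀ : θ y₀ = 2 * x₁ + t * x₀)
    (h₁ : θ y₁ = -(2 * x₀ + t * x₁)) : IsDualRow F θ (gramInv t) x₀ x₁ !![y₀, y₁; 0, 0] := by
  refine ⟨⟨y₀, hy₀⟩, ⟨y₁, hy₁⟩, -(4 - t ^ 2)⁻¹, neg_ne_zero.2 (inv_ne_zero ht), rfl, ?_, ?_⟩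
  · simp [gramInv, h₁]
    ring
  · simp [gramInv, h₀]
    ring

/-- Write `r = 2s`. Since `α ^ q ^ r = α⁻¹`, the element `α + α⁻¹` is fixed by `q ^ (2s)` and has
degree at most `s`. This bounds the dimension, and shows that `q ^ (r - 1)` inverts the
`q`-Frobenius on `K(α + α⁻¹)`. -/
theorem hasComponent_J1 {α : L} (hq : Nat.card K = q ^ 2) (hi : IsIntegral K α) (h0 : α ≠ 0)
    (hn : α ^ n = 1) (hsep : (blockPoly q (minpoly K α) .J1).Separable)
    (hc : minpoly K α = recip (minpoly K α)) (hne : minpoly K α ≠ conjPoly q (minpoly K α)) :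
    HasComponent q n (minpoly K α) α .J1 := by
  rw [recip_minpoly hi h0] at hc
  have hinv : α ≠ α⁻¹ := fun h =>
    hne (by rw [conjPoly_minpoly hq hi, minpoly_pow_eq_of_eq_inv hq h0 h])
  obtain ⟨⟨s, hs⟩, hfix⟩ := pow_natDegree_eq_inv_of_inv_conj hq hi hinv
    (by rw [hc]; exact minpoly.aeval K _)
  have hpos := minpoly.natDegree_pos hi
  obtain ⟨θ, hθ⟩ := exists_ringHom_pow hq L 1
  simp only [pow_one] at hθ
  obtain ⟨τ, hτ⟩ := exists_ringHom_pow hq L ((minpoly K α).natDegree - 1)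
  have h0q : α ^ q ≠ 0 := pow_ne_zero q h0
  have hinvq : α ^ q ≠ (α ^ q)⁻¹ := by
    rw [← inv_pow, ← hθ, ← hθ]
    exact θ.injective.ne hinv
  have hnq : (α ^ q) ^ n = 1 := by rw [pow_right_comm, hn, one_pow]
  have htq : (α + α⁻¹) ^ q = α ^ q + (α ^ q)⁻¹ := by
    rw [← hθ, map_add, map_inv₀, hθ]
  have hti : IsIntegral K (α + α⁻¹) := hi.add hi.inv
  have htfix : (α + α⁻¹) ^ q ^ (2 * s) = α + α⁻¹ := by
    rw [add_pow_pow hq, inv_pow, two_mul, ← hs, hfix, inv_inv, add_comm]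
  have hdeg : (minpoly K (α + α⁻¹)).natDegree ≤ s :=
    Nat.le_of_dvd (by omega) ((natDegree_minpoly_dvd_iff hq hti).2 htfix)
  have hdegq : (minpoly K (α ^ q + (α ^ q)⁻¹)).natDegree ≤ s := by
    rw [← htq, natDegree_minpoly_pow hq hti]
    exact hdeg
  have hadj : K⟮α ^ q + (α ^ q)⁻¹⟯ = K⟮α + α⁻¹⟯ := by
    rw [← htq, adjoin_pow_eq_adjoin hq hti]
  have htmem := IntermediateField.mem_adjoin_simple_self K (α + α⁻¹)
  have hfixq : ∀ {x : L}, x ∈ K⟮α + α⁻¹⟯ → (x ^ q ^ ((minpoly K α).natDegree - 1)) ^ q = x := by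
    intro x hx
    rw [← pow_mul, ← pow_succ, Nat.sub_add_cancel (by omega), hs, ← two_mul]
    exact pow_pow_eq_of_mem_adjoin hq htfix hx
  have hτθ : ∀ {x : L}, x ∈ K⟮α + α⁻¹⟯ → τ (x ^ q) = x := by
    intro x hx
    rw [hτ, pow_right_comm]
    exact hfixq hx
  obtain ⟨ρ₁, ha₁, hb₁⟩ := exists_sigma_algHom (n := n) htmem hinv hn
  obtain ⟨ρ₂, ha₂, hb₂⟩ := exists_sigma_algHom (n := n)
    (IntermediateField.mem_adjoin_simple_self K (α ^ q + (α ^ q)⁻¹)) hinvq hnq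
  have hd := four_sub_sq_ne_zero h0 hinv
  have hdq : 4 - ((α + α⁻¹) ^ q) ^ 2 ≠ 0 := by
    rw [htq]
    exact four_sub_sq_ne_zero h0q hinvq
  obtain ⟨hfin, hrank⟩ := finrank_M2_prod hti ((hi.pow q).add (hi.pow q).inv)
  have hblock : blockPoly q (minpoly K α) .J1 = minpoly K α * minpoly K (α ^ q) := by
    rw [← conjPoly_minpoly hq hi, blockPoly]
  rw [hblock] at hsep
  refine ⟨hfin, ?_, ρ₁.prod ρ₂, ⟨⟨ha₁, ha₂⟩, hb₁, hb₂⟩, ?_, fun hρ I => ?_⟩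
  · rw [hblock, natDegree_mul (minpoly.ne_zero hi) (minpoly.ne_zero (hi.pow q)),
      natDegree_minpoly_pow hq hi]
    refine hrank.trans_le ?_
    omega
  · intro u hu
    obtain ⟨h1, h2⟩ := minpoly_dvd_polys (zMat_mul_inv hinv) ha₁ hb₁ (congrArg Prod.fst hu)
    obtain ⟨h3, h4⟩ := minpoly_dvd_polys (zMat_mul_inv hinvq) ha₂ hb₂ (congrArg Prod.snd hu)
    rw [hblock]
    exact ⟨mul_dvd_of_separable hsep h1.1 h3.1, mul_dvd_of_separable hsep h2.1 h4.1⟩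
  · rw [sigma_diagonal h0 hinv] at ha₁
    rw [sigma_swap hinv] at hb₁
    replace ha₂ := ha₂.trans (show _ = !![0, 1; -1, (α + α⁻¹) ^ q] by
      rw [sigma_diagonal h0q hinvq, htq])
    replace hb₂ := hb₂.trans (show _ = !![1, -(α + α⁻¹) ^ q; 0, -1] by rw [sigma_swap hinvq, htq])
    refine exists_dual_prod hρ (gramInv_mul_gram hd) (gramInv_mul_gram hdq)
      (toL_hermAdjoint hq ρ₂ ρ₁ ⟨s - 1, by omega⟩ hτ (gramInv_mul_gram hd)
        (by rw [ha₁, ha₂]; exact rotation_mul_gram_adjoint hd (hτθ htmem))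
        (by rw [hb₁, hb₂]; exact reflection_mul_gram_adjoint hd (hτθ htmem)))
      (toL_hermAdjoint hq ρ₁ ρ₂ odd_one (by simpa using hθ) (gramInv_mul_gram hdq)
        (by rw [ha₁, ha₂]; exact rotation_mul_gram_adjoint hdq (hθ _))
        (by rw [hb₁, hb₂]; exact reflection_mul_gram_adjoint hdq (hθ _)))
      ?_ (fun a => ?_) ?_ (fun a => ?_) I
    · exact isDualRow_gramInv hd (ofNat_mem _ 2) (neg_mem (hadj ▸ pow_mem htmem q))
        (by rw [map_ofNat]; ring) (by rw [map_neg, hτθ htmem]; ring)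
    · have hat : 2 * (a : L) + α + α⁻¹ ∈ K⟮α + α⁻¹⟯ := by
        rw [add_assoc]
        exact add_mem (mul_mem (ofNat_mem _ 2) a.2) htmem
      have hat' : -2 - (α + α⁻¹) * (a : L) ∈ K⟮α + α⁻¹⟯ :=
        sub_mem (neg_mem (ofNat_mem _ 2)) (mul_mem htmem a.2)
      exact isDualRow_gramInv hd (by rw [hadj]; exact pow_mem hat q)
        (by rw [hadj]; exact pow_mem hat' q) (by rw [hτθ hat]; ring) (by rw [hτθ hat']; ring)
    · exact isDualRow_gramInv hdq (ofNat_mem _ 2) (neg_mem htmem)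
        (by rw [map_ofNat]; ring) (by rw [map_neg, hθ]; ring)
    · have ham : (a : L) ∈ K⟮α + α⁻¹⟯ := by rw [← hadj]; exact a.2
      have hapow := pow_mem ham (q ^ ((minpoly K α).natDegree - 1))
      refine isDualRow_gramInv hdq ?_
        (sub_mem (neg_mem (ofNat_mem _ 2)) (mul_mem htmem hapow)) ?_ ?_
      · rw [add_assoc]
        exact add_mem (mul_mem (ofNat_mem _ 2) hapow) htmem
      · rw [add_assoc, map_add, map_mul, map_ofNat, hθ, hθ, hfixq ham]
        ring
      · rw [map_sub, map_mul, map_neg, map_ofNat, hθ, hθ, hfixq ham]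
        ring

end SelfReciprocal

end DihedralCodes

namespace DihedralCodes

open DihedralGroup

variable {K L : Type u} [Field K] [Finite K] [Field L] [Algebra K L] {q n : ℕ} [NeZero n]

/-! ### The components of class J0 -/

section SelfConjugate

omit [Finite K] in
theorem exists_minpoly_eq_X_sub_C {α : L} (h0 : α ≠ 0) (hinv : α = α⁻¹) :
    ∃ ε : K, (ε = 1 ∨ ε = -1) ∧ algebraMap K L ε = α ∧ minpoly K α = X - C ε := by
  obtain ⟨ε, hε, rfl⟩ := exists_algebraMap_eq_of_eq_inv (K := K) h0 hinv
  exact ⟨ε, hε, rfl, minpoly.eq_X_sub_C L ε⟩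

theorem add_pow_card (hq : Nat.card K = q ^ 2) (x y : K) : (x + y) ^ q = x ^ q + y ^ q := by
  simpa using add_pow_pow (L := K) hq x y 1

omit [Finite K] in
theorem aeval_prod_mk {R S : Type*} [Ring R] [Ring S] [Algebra K R] [Algebra K S] (x : R) (y : S)
    (p : K[X]) : aeval (x, y) p = (aeval x p, aeval y p) := by
  have h1 : (aeval (x, y) p).1 = aeval x p :=
    (aeval_algHom_apply (AlgHom.fst K R S) (x, y) p).symm
  have h2 : (aeval (x, y) p).2 = aeval y p :=
    (aeval_algHom_apply (AlgHom.snd K R S) (x, y) p).symm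
  exact Prod.ext h1 h2

omit [Finite K] in
theorem exists_dual_field (q : ℕ) (hq0 : q ≠ 0) (I : Ideal K) :
    (I = ⊥ ∧ ∀ x : K, (∀ w ∈ I, w * x ^ q = 0) ↔ x ∈ (⊤ : Ideal K)) ∨
      (I = ⊤ ∧ ∀ x : K, (∀ w ∈ I, w * x ^ q = 0) ↔ x ∈ (⊥ : Ideal K)) := by
  rcases Ideal.eq_bot_or_top I with rfl | rfl
  · left
    refine ⟨rfl, fun x => ?_⟩
    simp
  · right
    refine ⟨rfl, fun x => ?_⟩
    rw [Ideal.mem_bot]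
    constructor
    · intro h
      have := h 1 trivial
      rw [one_mul] at this
      exact eq_zero_of_pow_eq_zero this
    · rintro rfl w -
      rw [zero_pow hq0, mul_zero]

/-- In the commutative ring `K × K` the adjoint raises both coordinates to the power `q`, so each of
the two ideals `0` and `K` is exchanged with the other, coordinate by coordinate. -/
theorem hasComponent_J0odd {α : L} (hq : Nat.card K = q ^ 2) (hi : IsIntegral K α) (h0 : α ≠ 0)
    (hn : α ^ n = 1) (hinv : α = α⁻¹) (hchar : ringChar K ≠ 2) :
    HasComponent q n (minpoly K α) α .J0odd := by
  have h2 : (2 : K) ≠ 0 := Ring.two_ne_zero hchar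
  have hq0 := ne_zero_of_card hq
  obtain ⟨ε, hε, hεα, hmin⟩ := exists_minpoly_eq_X_sub_C (K := K) h0 hinv
  have hεε : ε * ε = 1 := by rcases hε with rfl | rfl <;> simp
  have hεq : ε ^ q * ε = 1 := by
    obtain ⟨θ, hθ⟩ := exists_ringHom_pow hq K 1
    simp only [pow_one] at hθ
    rw [← hθ]
    rcases hε with rfl | rfl <;> simp
  have hεn : ε ^ n = 1 := by
    apply (algebraMap K L).injective
    rw [map_pow, hεα, hn, map_one]
  have hnegq : (-1 : K) ^ q = -1 := by
    obtain ⟨θ, hθ⟩ := exists_ringHom_pow hq K 1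
    simp only [pow_one] at hθ
    rw [← hθ]
    simp
  obtain ⟨ρ, ha, hb⟩ := exists_algHom_dihedral (K := K) (n := n) ((ε, ε) : K × K) (1, -1)
    (by rw [Prod.pow_mk, hεn]; rfl) (by simp) (by simp [hεε])
  refine ⟨inferInstanceAs (Module.Finite K (K × K)), ?_, ρ, ⟨ha.trans ?_, hb⟩, ?_, fun hρ I => ?_⟩
  · have h : Module.finrank K (K × K) = 2 := by simp
    refine (le_of_eq h).trans ?_
    rw [blockPoly]
    have := minpoly.natDegree_pos hi
    omega
  · by_cases h : minpoly K α = X - 1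
    · rw [if_pos h]
      rw [hmin, ← C_1] at h
      rw [C_injective (sub_right_injective h)]
    · rw [if_neg h]
      rcases hε with rfl | rfl
      · exact absurd hmin (by rwa [C_1])
      · rfl
  · intro u hu
    rw [algHom_eq_aeval, ha, hb, aeval_prod_mk, aeval_prod_mk] at hu
    have e1 : aeval ε (rotPoly u) + 1 * aeval ε (reflPoly u) = 0 := congrArg Prod.fst hu
    have e2 : aeval ε (rotPoly u) + -1 * aeval ε (reflPoly u) = 0 := congrArg Prod.snd hu
    -- The characters with `b ↦ 1` and `b ↦ -1` separate `R(ε)` from `S(ε)` because `2` is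
    -- invertible.
    have e3 : aeval ε (rotPoly u) = 0 := by
      have : 2 * aeval ε (rotPoly u) = 0 := by linear_combination e1 + e2
      exact (mul_eq_zero.1 this).resolve_left h2
    have e4 : aeval ε (reflPoly u) = 0 := by simpa [e3] using e1
    rw [blockPoly, hmin]
    exact ⟨dvd_iff_isRoot.2 (by simpa [coe_aeval_eq_eval] using e3),
      dvd_iff_isRoot.2 (by simpa [coe_aeval_eq_eval] using e4)⟩
  · let T : K × K →+ K × K :=
      { toFun := fun x => (x.1 ^ q, x.2 ^ q)
        map_zero' := by simp [hq0]
        map_add' := fun x y => by simp [add_pow_card hq] }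
    have hT : ∀ u, ρ (hermAdjoint q u) = T (ρ u) := by
      refine algHom_hermAdjoint hq0 (add_pow_card hq) ρ ρ T ?_ ?_ ?_ ?_ ?_
      · simp [T]
      · intro x y
        simp [T, mul_pow, mul_comm]
      · intro c x
        simp [T, mul_pow]
      · rw [ha]
        simp [T, mul_comm ε, hεq]
      · rw [hb]
        simp [T, hnegq]
    have hI : I = Ideal.prod (Ideal.map (RingHom.fst K K) I) (Ideal.map (RingHom.snd K K) I) :=
      Ideal.ideal_prod_eq I
    rw [hI]
    have key : ∀ {I₁ I₂ J₁ J₂ : Ideal K}, (∀ x : K, (∀ w ∈ I₁, w * x ^ q = 0) ↔ x ∈ J₁) →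
        (∀ x : K, (∀ w ∈ I₂, w * x ^ q = 0) ↔ x ∈ J₂) →
        ∀ u, ρ u ∈ Ideal.prod J₁ J₂ ↔ ∀ w ∈ Ideal.prod I₁ I₂, w * ρ (hermAdjoint q u) = 0 := by
      intro I₁ I₂ J₁ J₂ h₁ h₂ u
      rw [hT, forall_mem_prod_mul_eq_zero_iff, Ideal.mem_prod]
      exact and_congr (h₁ _).symm (h₂ _).symm
    rcases exists_dual_field q hq0 (Ideal.map (RingHom.fst K K) I) with
      ⟨e₁, h₁⟩ | ⟨e₁, h₁⟩ <;>
    rcases exists_dual_field q hq0 (Ideal.map (RingHom.snd K K) I) with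
      ⟨e₂, h₂⟩ | ⟨e₂, h₂⟩
    · exact ⟨_, key h₁ h₂, Or.inl ⟨by rw [e₁, e₂], rfl⟩⟩
    · exact ⟨_, key h₁ h₂, Or.inr (Or.inr (Or.inl ⟨by rw [e₁, e₂], rfl⟩))⟩
    · exact ⟨_, key h₁ h₂, Or.inr (Or.inl ⟨by rw [e₁, e₂], rfl⟩)⟩
    · exact ⟨_, key h₁ h₂, Or.inr (Or.inr (Or.inr ⟨by rw [e₁, e₂], rfl⟩))⟩

omit [Finite K] in
theorem mem_KC2_iff {M : Matrix (Fin 2) (Fin 2) K} :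
    M ∈ Algebra.adjoin K ({!![0, 1; 1, 0]} : Set (Matrix (Fin 2) (Fin 2) K)) ↔
      M 0 0 = M 1 1 ∧ M 0 1 = M 1 0 := by
  constructor
  · intro h
    induction h using Algebra.adjoin_induction with
    | mem x hx => rw [Set.mem_singleton_iff.1 hx]; simp
    | algebraMap c => simp [Matrix.algebraMap_matrix_apply]
    | add x y _ _ hx hy => simp [hx, hy]
    | mul x y _ _ hx hy =>
      simp only [Matrix.mul_apply, Fin.sum_univ_two, hx, hy]
      constructor <;> ring
  · rintro ⟨h1, h2⟩
    have e : M = M 0 0 • 1 + M 0 1 • !![0, 1; 1, 0] := by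
      ext i k
      fin_cases i <;> fin_cases k <;> simp [h1, h2]
    have hS := Algebra.subset_adjoin (R := K)
      (Set.mem_singleton (!![0, 1; 1, 0] : Matrix (Fin 2) (Fin 2) K))
    rw [e]
    exact Subalgebra.add_mem _ (Subalgebra.smul_mem _ (Subalgebra.one_mem _) _)
      (Subalgebra.smul_mem _ hS _)

/-- The element `!![x, y; y, x]` of `KC2 K`. -/
def KC2.mk (x y : K) : KC2 K := ⟨!![x, y; y, x], mem_KC2_iff.2 ⟨rfl, rfl⟩⟩

omit [Finite K] in
theorem KC2.exists_eq_mk (z : KC2 K) : ∃ x y, z = KC2.mk x y := by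
  refine ⟨z.1 0 0, z.1 0 1, Subtype.ext ?_⟩
  obtain ⟨h1, h2⟩ := mem_KC2_iff.1 z.2
  rw [KC2.mk, Matrix.eta_fin_two z.1]
  simp [h1, h2]

omit [Finite K] in
theorem KC2.mk_mul_mk (x y x' y' : K) :
    KC2.mk x y * KC2.mk x' y' = KC2.mk (x * x' + y * y') (x * y' + y * x') := by
  apply Subtype.ext
  change !![x, y; y, x] * !![x', y'; y', x'] = !![_, _; _, _]
  rw [Matrix.mul_fin_two]
  ext i k
  fin_cases i <;> fin_cases k <;> simp <;> ring

omit [Finite K] in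
theorem KC2.mk_inj {x y x' y' : K} : KC2.mk x y = KC2.mk x' y' ↔ x = x' ∧ y = y' := by
  constructor
  · intro h
    have h' := congrArg Subtype.val h
    exact ⟨congrFun (congrFun h' 0) 0, congrFun (congrFun h' 0) 1⟩
  · rintro ⟨rfl, rfl⟩
    rfl

omit [Finite K] in
theorem KC2.mk_zero : KC2.mk (0 : K) 0 = 0 := by
  apply Subtype.ext
  ext i k
  fin_cases i <;> fin_cases k <;> rfl

omit [Finite K] in
theorem KC2.mk_one : KC2.mk (1 : K) 0 = 1 := by
  apply Subtype.ext
  exact Matrix.one_fin_two.symm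

omit [Finite K] in
theorem KC2.finrank_le : Module.finrank K (KC2 K) ≤ 2 := by
  let φ : KC2 K →ₗ[K] K × K :=
    { toFun := fun z => (z.1 0 0, z.1 0 1)
      map_add' := fun _ _ => rfl
      map_smul' := fun _ _ => rfl }
  have hφ : Function.Injective φ := by
    intro z w h
    obtain ⟨x, y, rfl⟩ := z.exists_eq_mk
    obtain ⟨x', y', rfl⟩ := w.exists_eq_mk
    exact KC2.mk_inj.2 ⟨congrArg Prod.fst h, congrArg Prod.snd h⟩
  simpa using LinearMap.finrank_le_finrank_of_injective hφ

omit [Finite K] in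
theorem KC2.mem_span_norm_iff {x y : K} : KC2.mk x y ∈ Ideal.span {KC2.mk (1 : K) 1} ↔ x = y := by
  rw [Ideal.mem_span_singleton']
  constructor
  · rintro ⟨z, hz⟩
    obtain ⟨a, b, rfl⟩ := z.exists_eq_mk
    rw [KC2.mk_mul_mk, KC2.mk_inj] at hz
    rw [← hz.1, ← hz.2]
  · rintro rfl
    exact ⟨KC2.mk x 0, by rw [KC2.mk_mul_mk]; simp⟩

section CharTwo

variable [CharP K 2]

omit [Finite K] in
-- In characteristic two the square of the element with entries `x, y` is the scalar `(x + y) ^ 2`.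
-- So elements with `x ≠ y` are units and the others form a line.
theorem KC2.ideal_eq (I : Ideal (KC2 K)) :
    I = ⊥ ∨ I = Ideal.span {KC2.mk 1 1} ∨ I = ⊤ := by
  by_cases hne : ∃ x y, KC2.mk x y ∈ I ∧ x ≠ y
  · right; right
    obtain ⟨x, y, hI, hxy⟩ := hne
    have hadd : x + y ≠ 0 := fun h => hxy (CharTwo.add_eq_zero.1 h)
    have h := I.mul_mem_left (KC2.mk ((x + y) ^ 2)⁻¹ 0 * KC2.mk x y) hI
    rw [Ideal.eq_top_iff_one, ← KC2.mk_one]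
    convert h using 1
    rw [mul_assoc, KC2.mk_mul_mk, KC2.mk_mul_mk, KC2.mk_inj]
    constructor
    · rw [zero_mul, add_zero, ← sq, ← sq, ← CharTwo.add_sq,
        inv_mul_cancel₀ (pow_ne_zero 2 hadd)]
    · rw [mul_comm y x, CharTwo.add_self_eq_zero]
      simp
  push Not at hne
  by_cases hbot : I = ⊥
  · exact Or.inl hbot
  right; left
  obtain ⟨z, hz, hz0⟩ := Submodule.exists_mem_ne_zero_of_ne_bot hbot
  obtain ⟨x, y, rfl⟩ := z.exists_eq_mk
  obtain rfl := hne x y hz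
  have hx : x ≠ 0 := by
    rintro rfl
    exact hz0 KC2.mk_zero
  apply le_antisymm
  · intro w hw
    obtain ⟨a, b, rfl⟩ := w.exists_eq_mk
    exact KC2.mem_span_norm_iff.2 (hne a b hw)
  · rw [Ideal.span_singleton_le_iff_mem]
    convert I.mul_mem_left (KC2.mk x⁻¹ 0) hz using 1
    rw [KC2.mk_mul_mk]
    simp [hx]

/-- The adjoint raises the entries to the power `q`, and the middle ideal annihilates exactly the
elements with `x ^ q + y ^ q = 0`, that is `x = y`; hence it is its own dual. -/
theorem hasComponent_J0two {α : L} (hq : Nat.card K = q ^ 2) (hi : IsIntegral K α) (h0 : α ≠ 0)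
    (hinv : α = α⁻¹) : HasComponent q n (minpoly K α) α .J0two := by
  have hq0 := ne_zero_of_card hq
  obtain ⟨ε, hε, -, hmin⟩ := exists_minpoly_eq_X_sub_C (K := K) h0 hinv
  obtain rfl : ε = 1 := by
    rcases hε with h | h
    · exact h
    · rw [h, CharTwo.neg_eq]
  obtain ⟨θ, hθ⟩ := exists_ringHom_pow hq K 1
  simp only [pow_one] at hθ
  obtain ⟨ρ, ha, hb⟩ := exists_algHom_dihedral (K := K) (n := n) (1 : KC2 K) (KC2.mk 0 1)
    (one_pow n) (by rw [KC2.mk_mul_mk, ← KC2.mk_one]; simp) (by rw [one_mul, mul_one])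
  have hstar : ∀ u x y, ρ u = KC2.mk x y → ρ (hermAdjoint q u) = KC2.mk (x ^ q) (y ^ q) := by
    intro u x y hu
    have h := algHom_hermAdjoint_matrix hq0 (add_pow_card hq) ((Subalgebra.val _).comp ρ)
      ((Subalgebra.val _).comp ρ) θ (fun c => hθ c) 1 1 (one_mul 1) ?_ ?_ u
    · apply Subtype.ext
      change ((Subalgebra.val _).comp ρ) _ = _
      rw [h, AlgHom.comp_apply, hu]
      change 1 * ((!![x, y; y, x] : Matrix (Fin 2) (Fin 2) K).map θ).transpose * 1 =
        !![x ^ q, y ^ q; y ^ q, x ^ q]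
      rw [one_mul, mul_one]
      ext i k
      fin_cases i <;> fin_cases k <;> simp [hθ]
    · rw [AlgHom.comp_apply, ha, map_one, Matrix.map_one _ (map_zero θ) (map_one θ)]
      simp
    · rw [AlgHom.comp_apply, hb]
      change !![0, 1; 1, 0] * (1 * ((!![0, 1; 1, 0] : Matrix (Fin 2) (Fin 2) K).map θ).transpose * 1) = 1
      have e : ((!![0, 1; 1, 0] : Matrix (Fin 2) (Fin 2) K).map θ).transpose =
          !![0, 1; 1, 0] := by
        ext i k
        fin_cases i <;> fin_cases k <;> simp
      rw [e, one_mul, mul_one, swap_mul_swap]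
  refine ⟨inferInstanceAs (Module.Finite K (KC2 K)), ?_, ρ, ⟨?_, ?_⟩, ?_, fun hρ I => ?_⟩
  · refine (KC2.finrank_le (K := K)).trans ?_
    rw [blockPoly]
    have := minpoly.natDegree_pos hi
    omega
  · rw [ha]
    exact Matrix.one_fin_two
  · rw [hb]
    rfl
  · intro u hu
    have haev : ∀ p : K[X], aeval (1 : KC2 K) p = KC2.mk (p.eval 1) 0 := by
      intro p
      rw [← map_one (algebraMap K (KC2 K)), aeval_algebraMap_apply, coe_aeval_eq_eval]
      apply Subtype.ext
      ext i k
      fin_cases i <;> fin_cases k <;>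
        simp [KC2.mk, Matrix.algebraMap_matrix_apply]
    rw [algHom_eq_aeval, ha, hb, haev, haev, KC2.mk_mul_mk] at hu
    have h1 : (rotPoly u).eval 1 = 0 := by
      have := congrFun (congrFun (congrArg Subtype.val hu) 0) 0
      simpa [KC2.mk] using this
    have h2 : (reflPoly u).eval 1 = 0 := by
      have := congrFun (congrFun (congrArg Subtype.val hu) 0) 1
      simpa [KC2.mk] using this
    rw [blockPoly, hmin]
    exact ⟨dvd_iff_isRoot.2 h1, dvd_iff_isRoot.2 h2⟩
  · have hset : {x : KC2 K | (x : Matrix (Fin 2) (Fin 2) K) = !![1, 1; 1, 1]} = {KC2.mk 1 1} := by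
      ext x
      exact ⟨fun h => Subtype.ext h, fun h => congrArg Subtype.val h⟩
    rcases KC2.ideal_eq I with rfl | rfl | rfl
    · refine ⟨⊤, fun u => ?_, Or.inl ⟨rfl, rfl⟩⟩
      constructor
      · intro _ w hw
        rw [(Submodule.mem_bot _).1 hw, zero_mul]
      · exact fun _ => trivial
    · refine ⟨Ideal.span {KC2.mk 1 1}, fun u => ?_, Or.inr (Or.inl ?_)⟩
      · obtain ⟨x, y, hu⟩ := KC2.exists_eq_mk (ρ u)
        rw [hstar u x y hu, hu]
        refine KC2.mem_span_norm_iff.trans (Iff.trans ?_ forall_mem_span_mul_eq_zero_iff.symm)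
        rw [KC2.mk_mul_mk, ← KC2.mk_zero, KC2.mk_inj, one_mul, one_mul, add_comm (y ^ q), and_self,
          CharTwo.add_eq_zero, ← hθ, ← hθ, θ.injective.eq_iff]
      · rw [hset]
        exact ⟨rfl, rfl⟩
    · refine ⟨⊥, fun u => ?_, Or.inr (Or.inr ⟨rfl, rfl⟩)⟩
      obtain ⟨x, y, hu⟩ := KC2.exists_eq_mk (ρ u)
      rw [hstar u x y hu, hu]
      refine (Submodule.mem_bot _).trans ⟨?_, fun h => ?_⟩
      · intro h w _
        rw [← KC2.mk_zero, KC2.mk_inj] at h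
        rw [h.1, h.2, zero_pow hq0, KC2.mk_zero]
        exact mul_zero w
      · have h1 := h 1 trivial
        replace h1 : KC2.mk (x ^ q) (y ^ q) = 0 := (one_mul _).symm.trans h1
        rw [← KC2.mk_zero, KC2.mk_inj] at h1
        rw [eq_zero_of_pow_eq_zero h1.1, eq_zero_of_pow_eq_zero h1.2, KC2.mk_zero]

end CharTwo

end SelfConjugate

end DihedralCodes

namespace DihedralCodes

open DihedralGroup

/-! ### Gluing the components -/

section Assembly

/-- Multiplication by the central idempotents of the factors stays in the ideal, so the `j`-th
component can be recovered from the elements supported at `j`. -/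
theorem existsUnique_ideal_pi {J : Type*} [Finite J] {R : J → Type*} [∀ j, Ring (R j)]
    (A : Ideal (∀ j, R j)) :
    ∃! I : ∀ j, Ideal (R j), (A : Set (∀ j, R j)) = {x | ∀ j, x j ∈ I j} := by
  classical
  have := Fintype.ofFinite J
  let I : ∀ j, Ideal (R j) := fun j =>
    { carrier := {y | Pi.single j y ∈ A}
      zero_mem' := by
        change Pi.single j 0 ∈ A
        rw [Pi.single_zero]
        exact A.zero_mem
      add_mem' := fun {y z} hy hz => by
        change Pi.single j (y + z) ∈ A
        rw [Pi.single_add]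
        exact A.add_mem hy hz
      smul_mem' := fun c y hy => by
        change Pi.single j (c * y) ∈ A
        rw [Pi.single_mul]
        exact A.mul_mem_left _ hy }
  refine ⟨I, ?_, fun I' hI' => ?_⟩
  · ext x
    constructor
    · intro hx j
      change Pi.single j (x j) ∈ A
      have e : Pi.single j (x j) = Pi.single j 1 * x := by
        funext k
        by_cases hk : k = j
        · subst hk
          simp
        · simp [Pi.single_eq_of_ne hk]
      rw [e]
      exact A.mul_mem_left _ hx
    · intro hx
      rw [SetLike.mem_coe, ← Finset.univ_sum_single x]
      exact A.sum_mem fun j _ => hx j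
  · funext j
    ext y
    change y ∈ I' j ↔ Pi.single j y ∈ (A : Set (∀ j, R j))
    rw [hI']
    constructor
    · intro hy k
      by_cases hk : k = j
      · subst hk
        rwa [Pi.single_eq_same]
      · rw [Pi.single_eq_of_ne hk]
        exact (I' k).zero_mem
    · intro h
      have := h j
      rwa [Pi.single_eq_same] at this

variable {K L : Type u} [Field K] [Finite K] [Field L] [Algebra K L] {q n : ℕ}

omit [Finite K] in
theorem dvd_blockPoly (q : ℕ) (f : K[X]) (c : FactorClass) : f ∣ blockPoly q f c := by
  cases c with
  | J0odd => exact dvd_rfl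
  | J0two => exact dvd_rfl
  | J1 => exact dvd_mul_right _ _
  | J2 => exact dvd_mul_right _ _
  | J3 => exact dvd_mul_right _ _
  | J4 => exact ((dvd_mul_right _ _).mul_right _).mul_right _

theorem hasComponent_factorClass [NeZero n] (hq : Nat.card K = q ^ 2) {f : K[X]} (hmon : f.Monic)
    (hirr : Irreducible f) {α : L} (hα : aeval α f = 0) (hn : α ^ n = 1)
    (hsep : (blockPoly q f (factorClass q f)).Separable) :
    HasComponent q n f α (factorClass q f) := by
  have hi : IsIntegral K α := ⟨f, hmon, hα⟩
  have h0 : α ≠ 0 := by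
    rintro rfl
    rw [zero_pow (NeZero.ne n)] at hn
    exact zero_ne_one hn
  obtain rfl : f = minpoly K α := minpoly.eq_of_irreducible_of_monic hirr hα hmon
  have hinv : minpoly K α = conjPoly q (minpoly K α) → minpoly K α = recip (minpoly K α) →
      α = α⁻¹ := fun h1 h2 =>
    eq_inv_of_minpoly_eq hq hi (h1.trans (conjPoly_minpoly hq hi)) (h2.trans (recip_minpoly hi h0))
  rw [factorClass] at hsep ⊢
  split_ifs at hsep ⊢ with h1 h2 h3 h4 h5
  · have := ringChar.of_eq h2
    exact hasComponent_J0two hq hi h0 (hinv h1.1 h1.2)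
  · exact hasComponent_J0odd hq hi h0 hn (hinv h1.1 h1.2) h2
  · exact hasComponent_J1 hq hi h0 hn hsep h3 fun h => h1 ⟨h, h3⟩
  · exact hasComponent_J2 hq hi h0 hn hsep h4
  · exact hasComponent_J3 hq hi h0 hn hsep h5
  · exact hasComponent_J4 hq hi h0 hn hsep

theorem separable_X_pow_sub_one (hq : Nat.card K = q ^ 2) (hqn : Nat.Coprime q n) :
    (X ^ n - 1 : K[X]).Separable := by
  have := Fintype.ofFinite K
  rw [X_pow_sub_one_separable_iff]
  intro hn
  have hq' : (q : K) = 0 := by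
    have h := FiniteField.cast_card_eq_zero K
    rw [← Nat.card_eq_fintype_card, hq, Nat.cast_pow] at h
    exact eq_zero_of_pow_eq_zero h
  obtain ⟨a, b, hab⟩ := Nat.isCoprime_iff_coprime.2 hqn
  have h := congrArg (Int.cast : ℤ → K) hab
  push_cast at h
  rw [hn, hq', mul_zero, mul_zero, add_zero] at h
  exact zero_ne_one h

omit [Finite K] in
theorem finrank_monoidAlgebra_dihedral [NeZero n] :
    Module.Finite K (MonoidAlgebra K (DihedralGroup n)) ∧
      Module.finrank K (MonoidAlgebra K (DihedralGroup n)) = 2 * n := by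
  let e := MonoidAlgebra.coeffLinearEquiv (S := K) (M := DihedralGroup n) K
  refine ⟨Module.Finite.equiv e.symm, ?_⟩
  rw [e.finrank_eq, Module.finrank_finsupp_self, DihedralGroup.card]

/-- Separability of `x ^ n - 1` makes the blocks coprime, which gives injectivity. The dimension
bounds add up to `2n`, which gives surjectivity, and this in turn is what the dual ideals of the
components require. -/
theorem exists_component_algEquiv [NeZero n] (hq : Nat.card K = q ^ 2) (hqn : Nat.Coprime q n)
    {J : Type*} [Fintype J] {f : J → K[X]} (hf : IsBlockFactorization q n f) {α : J → L}
    (hα : ∀ j, aeval (α j) (f j) = 0) :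
    ∃ ρ : MonoidAlgebra K (DihedralGroup n) ≃ₐ[K] (∀ j, Comp K q (α j) (factorClass q (f j))),
      (∀ j, IsGeneratorImage q (f j) (α j) (factorClass q (f j))
        (ρ (MonoidAlgebra.of K _ (r 1)) j) (ρ (MonoidAlgebra.of K _ (sr 0)) j)) ∧
      ∀ j, ∀ I : Ideal (Comp K q (α j) (factorClass q (f j))),
        ∃ I' : Ideal (Comp K q (α j) (factorClass q (f j))),
          (∀ u, ρ u j ∈ I' ↔ ∀ w ∈ I, w * ρ (hermAdjoint q u) j = 0) ∧
          IsDualComponent q (f j).natDegree (α j) (factorClass q (f j)) I I' := by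
  classical
  obtain ⟨hmon, hirr, hprod⟩ := hf
  have hsep := separable_X_pow_sub_one hq hqn
  have hblock : ∀ j, blockPoly q (f j) (factorClass q (f j)) ∣ X ^ n - 1 := fun j => by
    rw [hprod]
    exact Finset.dvd_prod_of_mem _ (Finset.mem_univ j)
  have hroot : ∀ j, α j ^ n = 1 := by
    intro j
    have h := aeval_eq_zero_of_dvd_aeval_eq_zero ((dvd_blockPoly q _ _).trans (hblock j)) (hα j)
    simpa [sub_eq_zero] using h
  have hcop : ∀ i j, i ≠ j → IsCoprime (blockPoly q (f i) (factorClass q (f i)))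
      (blockPoly q (f j) (factorClass q (f j))) := by
    intro i j hij
    apply Separable.isCoprime
    refine hsep.of_dvd ?_
    rw [hprod, ← Finset.mul_prod_erase _ _ (Finset.mem_univ i)]
    exact mul_dvd_mul_left _ (Finset.dvd_prod_of_mem _ (Finset.mem_erase.2 ⟨hij.symm, Finset.mem_univ j⟩))
  choose hfin hrank ρ hgen hker hdual using fun j => hasComponent_factorClass hq (hmon j) (hirr j)
    (hα j) (hroot j) (hsep.of_dvd (hblock j))
  let Φ := AlgHom.pi ρ
  have hΦ : Function.Injective Φ := by
    rw [injective_iff_map_eq_zero]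
    intro u hu
    have hj : ∀ j, ρ j u = 0 := fun j => congrFun hu j
    have hdvd : ∀ p : K[X], (∀ j, blockPoly q (f j) (factorClass q (f j)) ∣ p) →
        (X ^ n - 1 : K[X]) ∣ p := fun p hp => by
      rw [hprod]
      exact Finset.prod_dvd_of_coprime (fun i _ j _ hij => hcop i j hij) fun j _ => hp j
    exact eq_zero_of_dvd_polys (hdvd _ fun j => (hker j u (hj j)).1)
      (hdvd _ fun j => (hker j u (hj j)).2)
  have hdeg : ∑ j, (blockPoly q (f j) (factorClass q (f j))).natDegree = n := by
    have hne : (X ^ n - 1 : K[X]) ≠ 0 := hsep.ne_zero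
    rw [hprod, Finset.prod_ne_zero_iff] at hne
    rw [← natDegree_prod _ _ hne, ← hprod, ← C_1, natDegree_X_pow_sub_C]
  obtain ⟨hfinG, hrankG⟩ := finrank_monoidAlgebra_dihedral (K := K) (n := n)
  have hrankΦ : Module.finrank K (∀ j, Comp K q (α j) (factorClass q (f j))) ≤ 2 * n := by
    rw [Module.finrank_pi_fintype, ← hdeg, Finset.mul_sum]
    exact Finset.sum_le_sum fun j _ => hrank j
  have hsurj : Function.Surjective Φ := by
    have hle := LinearMap.finrank_le_finrank_of_injective (f := Φ.toLinearMap) hΦ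
    exact (LinearMap.injective_iff_surjective_of_finrank_eq_finrank (f := Φ.toLinearMap)
      (by omega)).1 hΦ
  refine ⟨AlgEquiv.ofBijective Φ ⟨hΦ, hsurj⟩, hgen, fun j I => ?_⟩
  refine hdual j (fun y => ?_) I
  obtain ⟨u, hu⟩ := hsurj (Function.update 0 j y)
  refine ⟨u, (congrFun hu j).trans ?_⟩
  rw [Function.update_self]

end Assembly

end DihedralCodes

theorem theorem3p6 {K L : Type u} [Field K] [Finite K] [Field L] [Algebra K L]
    (q n : ℕ) (hq : Nat.card K = q ^ 2) (hqn : Nat.Coprime q n)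
    {J : Type*} [Fintype J] (f : J → K[X]) (hf : IsBlockFactorization q n f)
    (α : J → L) (hα : ∀ j, aeval (α j) (f j) = 0) :
    ∃ ρ : MonoidAlgebra K (DihedralGroup n) ≃ₐ[K]
        (∀ j, Comp K q (α j) (factorClass q (f j))),
      (∀ j, IsGeneratorImage q (f j) (α j) (factorClass q (f j))
        (ρ (MonoidAlgebra.of K _ (DihedralGroup.r 1)) j)
        (ρ (MonoidAlgebra.of K _ (DihedralGroup.sr 0)) j)) ∧
      ∀ (φ : Fin (2 * n) ≃ DihedralGroup n) (C : Submodule K (Fin (2 * n) → K)),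
        IsGroupCode φ C →
        (∃! I : ∀ j, Ideal (Comp K q (α j) (factorClass q (f j))),
          ρ '' codeSet φ (C : Set (Fin (2 * n) → K)) = {x | ∀ j, x j ∈ I j}) ∧
        ∀ I : ∀ j, Ideal (Comp K q (α j) (factorClass q (f j))),
          ρ '' codeSet φ (C : Set (Fin (2 * n) → K)) = {x | ∀ j, x j ∈ I j} →
          ∃ I' : ∀ j, Ideal (Comp K q (α j) (factorClass q (f j))),
            ρ '' codeSet φ (hermitianDual q (C : Set (Fin (2 * n) → K))) = {x | ∀ j, x j ∈ I' j} ∧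
            ∀ j, IsDualComponent q (f j).natDegree (α j) (factorClass q (f j)) (I j) (I' j) := by
  classical
  -- Coprimality with `n = 0` would force `q = 1` and a field with one element.
  have hn : n ≠ 0 := by
    rintro rfl
    rw [Nat.coprime_zero_right] at hqn
    rw [hqn, one_pow] at hq
    exact Finite.one_lt_card.ne' hq
  have : NeZero n := ⟨hn⟩
  obtain ⟨ρ, hgen, hdual⟩ := exists_component_algEquiv hq hqn hf hα
  refine ⟨ρ, hgen, fun φ C hC => ⟨?_, fun I hI => ?_⟩⟩
  · obtain ⟨A, hA⟩ := hC
    have h : ρ '' codeSet φ (C : Set (Fin (2 * n) → K)) =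
        (A.comap ρ.symm : Set (∀ j, Comp K q (α j) (factorClass q (f j)))) := by
      rw [← hA]
      ext x
      constructor
      · rintro ⟨u, hu, rfl⟩
        simpa using hu
      · intro hx
        exact ⟨ρ.symm x, hx, ρ.apply_symm_apply x⟩
    rw [h]
    exact existsUnique_ideal_pi _
  · choose I' hmem hI' using fun j => hdual j (I j)
    refine ⟨I', ?_, hI'⟩
    have key : ∀ y, y ∈ codeSet φ (hermitianDual q (C : Set (Fin (2 * n) → K))) ↔
        ∀ j, ρ y j ∈ I' j := by
      intro y
      rw [mem_codeSet_hermitianDual_iff hC]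
      simp only [hmem]
      constructor
      · intro h j w hw
        -- Elements supported at a single `j` belong to the image of the code, so the global
        -- annihilator condition splits into one condition per component.
        have hs : Pi.single j w ∈ ρ '' codeSet φ (C : Set (Fin (2 * n) → K)) := by
          rw [hI]
          intro k
          by_cases hk : k = j
          · subst hk
            rwa [Pi.single_eq_same]
          · rw [Pi.single_eq_of_ne hk]
            exact (I k).zero_mem
        obtain ⟨x, hx, hxw⟩ := hs
        have h1 := congrFun (congrArg ρ (h x hx)) j
        rw [map_mul, hxw, map_zero] at h1
        simpa using h1
      · intro h x hx
        apply ρ.injective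
        rw [map_mul, map_zero]
        funext j
        have hs : ρ x ∈ {x | ∀ j, x j ∈ I j} := hI ▸ ⟨x, hx, rfl⟩
        exact h j _ (hs j)
    ext z
    constructor
    · rintro ⟨y, hy, rfl⟩
      exact (key y).1 hy
    · intro hz
      refine ⟨ρ.symm z, (key _).2 ?_, ρ.apply_symm_apply z⟩
      rw [ρ.apply_symm_apply]
      exact hz
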